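/- Let $\mathbb F\in\{\mathbb R,\mathbb C\}$, let $M_2(\mathbb F)$ be the $2\times 2$ matrices over $\mathbb F$ with the spectral norm $\|\cdot\|$ (largest singular value), let $\mathcal U_2(\mathbb F)=\{U\in M_2(\mathbb F): U^*U=I\}$, where $A^*$ is the conjugate transpose (the transpose if $\mathbb F=\mathbb R$), and let $$\mathbf V_3=\operatorname{Span}_{\mathbb R}\left\{I,\begin{bmatrix}0&i\\ i&0\end{bmatrix},\begin{bmatrix}0&1\\-1&0\end{bmatrix},\begin{bmatrix}i&0\\0&-i\end{bmatrix}\right\}\subset M_2(\mathbb C),$$ so that $M_2(\mathbb C)=\mathbf V_3\oplus i\mathbf V_3$. For $c>0$ let $\Phi_c\colon M_2(\mathbb R)\to M_2(\mathbb R)$ be the linear bijection with $$\Phi_c\left(\begin{bmatrix}a&b\\-b&a\end{bmatrix}\right)=\begin{bmatrix}a&b\\-b&a\end{bmatrix},\qquad \Phi_c\left(\begin{bmatrix}a&b\\b&-a\end{bmatrix}\right)=c\begin{bmatrix}a&b\\b&-a\end{bmatrix}\qquad(a,b\in\mathbb R).$$ **Theorem.** A bijective real-linear map $T\colon M_2(\mathbb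 F)\to M_2(\mathbb F)$ satisfies $$\|T(A)T(B)\|=\|T(A)\|\,\|T(B)\|\quad\text{whenever}\quad \|AB\|=\|A\|\,\|B\|$$ if and only if one of the following holds. (a) $\mathbb F=\mathbb R$ and there exist a nonzero $\gamma\in\mathbb R$, $c>0$ and $U\in\mathcal U_2(\mathbb R)$ such that $T(A)=\gamma U\Phi_c(A)U^*$ for all $A\in M_2(\mathbb R)$. (b) $\mathbb F=\mathbb C$ and there exist $U,V\in\mathcal U_2(\mathbb C)$, a nonzero $\gamma\in\mathbb C$ and $\mu\in\mathbb C\setminus\mathbb R$ such that the real-linear map $L\colon X\mapsto \gamma V\,T(UXU^*)\,V^*$ satisfies $L(X+iY)=X+\mu Y$ for all $X,Y\in\mathbf V_3$. Moreover, if in (b) $T$ is complex-linear, then $\mu=i$ in every such representation. -/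

import Mathlib

open scoped Matrix Matrix.Norms.L2Operator

/-- `2 × 2` matrices over `𝕜`. The norm on them is the spectral norm, that is, the operator norm
induced by the Euclidean norm on `𝕜²`. -/
abbrev Mat2 (𝕜 : Type*) : Type _ := Matrix (Fin 2) (Fin 2) 𝕜

/-- `T` preserves norm-multiplicative pairs. -/
def PreservesNormMulPairs {𝕜 : Type*} [RCLike 𝕜] (T : Mat2 𝕜 → Mat2 𝕜) : Prop :=
  ∀ A B : Mat2 𝕜, ‖A * B‖ = ‖A‖ * ‖B‖ → ‖T A * T B‖ = ‖T A‖ * ‖T B‖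

/-- The linear map `Φ_c` on `M₂(ℝ)`: writing `A = R + S` with `R` of the form `[a, b; -b, a]`
and `S` of the form `[a, b; b, -a]`, it sends `A` to `R + c S`. -/
noncomputable def rotReflScale (c : ℝ) : Mat2 ℝ →ₗ[ℝ] Mat2 ℝ where
  toFun A :=
    !![(A 0 0 + A 1 1) / 2, (A 0 1 - A 1 0) / 2; -((A 0 1 - A 1 0) / 2), (A 0 0 + A 1 1) / 2]
    + c • !![(A 0 0 - A 1 1) / 2, (A 0 1 + A 1 0) / 2;
             (A 0 1 + A 1 0) / 2, -((A 0 0 - A 1 1) / 2)]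
  map_add' A B := by
    ext i j
    fin_cases i <;> fin_cases j <;> simp <;> ring
  map_smul' r A := by
    ext i j
    fin_cases i <;> fin_cases j <;> simp <;> ring

theorem rotReflScale_rot (c a b : ℝ) :
    rotReflScale c !![a, b; -b, a] = !![a, b; -b, a] := by
  ext i j
  fin_cases i <;> fin_cases j <;> simp [rotReflScale]

theorem rotReflScale_refl (c a b : ℝ) :
    rotReflScale c !![a, b; b, -a] = c • !![a, b; b, -a] := by
  ext i j
  fin_cases i <;> fin_cases j <;> simp [rotReflScale]

theorem rotReflScale_comp_inv {c : ℝ} (hc : c ≠ 0) (A : Mat2 ℝ) :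
    rotReflScale c (rotReflScale c⁻¹ A) = A := by
  ext i j
  fin_cases i <;> fin_cases j <;> simp [rotReflScale] <;> field_simp <;> ring

theorem rotReflScale_bijective {c : ℝ} (hc : c ≠ 0) : Function.Bijective (rotReflScale c) := by
  refine Function.bijective_iff_has_inverse.2 ⟨rotReflScale c⁻¹, fun A => ?_, fun A => ?_⟩
  · simpa using rotReflScale_comp_inv (inv_ne_zero hc) A
  · exact rotReflScale_comp_inv hc A

/-- The real-linear span of `I`, `Σ₁ = [0, i; i, 0]`, `Σ₂ = [0, 1; -1, 0]` and
`Σ₃ = [i, 0; 0, -i]`; a copy of the quaternions inside `M₂(ℂ)`. -/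
noncomputable def quaternionSpace : Submodule ℝ (Mat2 ℂ) :=
  Submodule.span ℝ
    {1, !![0, Complex.I; Complex.I, 0], !![0, 1; -1, 0], !![Complex.I, 0; 0, -Complex.I]}

/-- The map `L : X ↦ γ V T(U X U*) V*` has the form `X + iY ↦ X + μY` for `X, Y` in the
quaternion space. -/
def HasQuaternionForm (T : Mat2 ℂ → Mat2 ℂ) (U V : Mat2 ℂ) (γ μ : ℂ) : Prop :=
  ∀ X ∈ quaternionSpace, ∀ Y ∈ quaternionSpace,
    γ • (V * T (U * (X + Complex.I • Y) * Uᴴ) * Vᴴ) = X + μ • Y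

/-! ### Spectral norms of 2 × 2 matrices through the Frobenius norm and the determinant -/

section NormOfProduct

variable {𝕜 : Type*} [RCLike 𝕜]

/-! Write `h` for half the squared Frobenius norm and `g` for half the gap between the squared
singular values. Then ‖A‖² = h + g and |det A|² = h² - g², and multiplicativity of the determinant
turns ‖AB‖ = ‖A‖‖B‖ into h(AB) = h(A)h(B) + g(A)g(B) (`norm_mul_eq_iff`). In suitable coordinates
h(AB) - h(A)h(B) is an inner product of two vectors of lengths g(A) and g(B), so
norm-multiplicativity is the equality case of Cauchy–Schwarz.

Over ℝ, let A be z ↦ αz + β z̄ on ℂ. The condition becomes αβ̄α'β' ≥ 0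
(`norm_matOfPair_mul_eq_iff`). A preserver respects the degenerate set αβ = 0, hence is block
diagonal or swaps the blocks; swapping is impossible, and testing a few pairs determines the
diagonal blocks (`diagonal_preservesPairs`).

Over ℂ, let A = X + iY with X, Y quaternions. The condition says that Im(X*Y) and Im(Y'X'*) lie on
the same ray (`norm_biquatMat_mul_eq_iff`). Multiples of unitaries, where Im(X*Y) = 0, pair with
everything and are therefore preserved; this forces the form X + iY ↦ z(φ(X) + μφ(Y))
(`PreservesNormMulPairs.exists_tensor_form`). The map φ inherits the ray condition, so after scaling
it fixes 1 and respects the cross product. It is thus a multiple of a quaternion conjugation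
(`PreservesPlanePairs.exists_conj`). -/

/-- Half of the squared Frobenius norm of a `2 × 2` matrix. -/
noncomputable def halfFrobSq (A : Mat2 𝕜) : ℝ :=
  (‖A 0 0‖ ^ 2 + ‖A 0 1‖ ^ 2 + ‖A 1 0‖ ^ 2 + ‖A 1 1‖ ^ 2) / 2

/-- Half of the difference of the squares of the singular values of a `2 × 2` matrix. -/
noncomputable def singularGap (A : Mat2 𝕜) : ℝ :=
  √(halfFrobSq A ^ 2 - ‖A.det‖ ^ 2)

theorem halfFrobSq_nonneg (A : Mat2 𝕜) : 0 ≤ halfFrobSq A := by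
  unfold halfFrobSq; positivity

theorem singularGap_nonneg (A : Mat2 𝕜) : 0 ≤ singularGap A := Real.sqrt_nonneg _

/-- Cayley–Hamilton for A*A, whose trace is twice `halfFrobSq A` and whose determinant is |det A|².
-/
theorem gram_sub_mul_self (A : Mat2 𝕜) :
    (Aᴴ * A - (halfFrobSq A : 𝕜) • 1) * (Aᴴ * A - (halfFrobSq A : 𝕜) • 1) =
      ((halfFrobSq A ^ 2 - ‖A.det‖ ^ 2 : ℝ) : 𝕜) • 1 := by
  have hdet : ((‖A.det‖ : 𝕜)) ^ 2 =
      (starRingEnd 𝕜 (A 0 0 * A 1 1 - A 0 1 * A 1 0)) * (A 0 0 * A 1 1 - A 0 1 * A 1 0) := by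
    rw [← Matrix.det_fin_two, RCLike.conj_mul]
  push_cast [halfFrobSq]
  rw [hdet]
  simp only [← RCLike.conj_mul]
  ext i j
  fin_cases i <;> fin_cases j <;>
    simp [Matrix.mul_apply, Fin.sum_univ_two] <;> ring

theorem norm_det_sq_le (A : Mat2 𝕜) : ‖A.det‖ ^ 2 ≤ halfFrobSq A ^ 2 := by
  set K := Aᴴ * A - (halfFrobSq A : 𝕜) • (1 : Mat2 𝕜) with hK
  have hKs : Kᴴ = K := by simp [hK, Matrix.conjTranspose_sub, Matrix.conjTranspose_mul]
  have h := congrFun (congrFun (gram_sub_mul_self A) 0) 0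
  rw [← hK] at h
  nth_rewrite 1 [← hKs] at h
  simp only [Matrix.mul_apply, Fin.sum_univ_two, Matrix.conjTranspose_apply, RCLike.star_def,
    RCLike.conj_mul, Matrix.smul_apply, Matrix.one_apply_eq, smul_eq_mul, mul_one] at h
  have h' : ‖K 0 0‖ ^ 2 + ‖K 1 0‖ ^ 2 = halfFrobSq A ^ 2 - ‖A.det‖ ^ 2 := by exact_mod_cast h
  nlinarith [sq_nonneg ‖K 0 0‖, sq_nonneg ‖K 1 0‖]

theorem singularGap_sq (A : Mat2 𝕜) :
    singularGap A ^ 2 = halfFrobSq A ^ 2 - ‖A.det‖ ^ 2 :=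
  Real.sq_sqrt (sub_nonneg.2 (norm_det_sq_le A))

/-- The traceless part K of A*A is self-adjoint with K² = g², so ‖K‖ = g by the C*-identity, and the
triangle inequality gives the upper bound. For the lower bound, the columns of K + g are
eigenvectors of A*A for h + g, unless K + g = 0; then tr K = 0 forces g = 0. -/
theorem norm_sq_eq (A : Mat2 𝕜) : ‖A‖ ^ 2 = halfFrobSq A + singularGap A := by
  set K := Aᴴ * A - (halfFrobSq A : 𝕜) • (1 : Mat2 𝕜) with hK
  have hKs : Kᴴ = K := by simp [hK, Matrix.conjTranspose_sub, Matrix.conjTranspose_mul]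
  have hK2 : K * K = ((singularGap A ^ 2 : ℝ) : 𝕜) • 1 := by
    rw [singularGap_sq]; exact gram_sub_mul_self A
  have ht := halfFrobSq_nonneg A
  have hk := singularGap_nonneg A
  have hAA : Aᴴ * A = (halfFrobSq A : 𝕜) • 1 + K := by rw [hK]; abel
  have hN : ‖A‖ ^ 2 = ‖Aᴴ * A‖ := by rw [Matrix.l2_opNorm_conjTranspose_mul_self]; ring
  have hnK : ‖K‖ = singularGap A := by
    have h1 : ‖K‖ * ‖K‖ = singularGap A ^ 2 := by
      rw [← Matrix.l2_opNorm_conjTranspose_mul_self, hKs, hK2, norm_smul, norm_one, mul_one,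
        RCLike.norm_ofReal, abs_of_nonneg (sq_nonneg _)]
    rw [← sq] at h1
    exact (sq_eq_sq₀ (norm_nonneg _) hk).1 h1
  apply le_antisymm
  · rw [hN, hAA]
    refine (norm_add_le _ _).trans ?_
    rw [norm_smul, norm_one, mul_one, RCLike.norm_ofReal, abs_of_nonneg ht, hnK]
  · set J := K + (singularGap A : 𝕜) • (1 : Mat2 𝕜) with hJ
    have hmul : (Aᴴ * A) * J = ((halfFrobSq A + singularGap A : ℝ) : 𝕜) • J := by
      rw [hAA, hJ, add_mul, mul_add K, hK2]
      simp only [Matrix.smul_mul, Matrix.mul_smul, one_mul, mul_one, smul_add, smul_smul]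
      push_cast
      module
    have hle : (halfFrobSq A + singularGap A) * ‖J‖ ≤ ‖A‖ ^ 2 * ‖J‖ := by
      rw [hN]
      refine le_trans (le_of_eq ?_) (norm_mul_le (Aᴴ * A) J)
      rw [hmul, norm_smul, RCLike.norm_ofReal, abs_of_nonneg (add_nonneg ht hk)]
    rcases eq_or_ne J 0 with h0 | h0
    · have htr : Matrix.trace J = ((2 * singularGap A : ℝ) : 𝕜) := by
        have : Matrix.trace K = 0 := by
          rw [hK, halfFrobSq]
          push_cast
          simp only [← RCLike.conj_mul]
          simp [Matrix.trace, Matrix.mul_apply, Fin.sum_univ_two]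
          ring
        rw [hJ, Matrix.trace_add, this, Matrix.trace_smul, Matrix.trace_one]
        push_cast
        simp
        ring
      rw [h0, Matrix.trace_zero] at htr
      have h2 : (2 * singularGap A : ℝ) = 0 := by exact_mod_cast htr.symm
      have h3 : singularGap A = 0 := by linarith
      have hK0 : K = 0 := by simpa [hJ, h3] using h0
      rw [hN, hAA, hK0, h3, add_zero, add_zero, norm_smul, norm_one, mul_one, RCLike.norm_ofReal,
        abs_of_nonneg ht]
    · exact le_of_mul_le_mul_right hle (norm_pos_iff.2 h0)

/-- Multiplicativity of h + g and of h² - g² gives, for nonzero factors, multiplicativity of h - g;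
adding the two relations isolates h(AB). -/
theorem norm_mul_eq_iff (A B : Mat2 𝕜) :
    ‖A * B‖ = ‖A‖ * ‖B‖ ↔
      halfFrobSq (A * B) = halfFrobSq A * halfFrobSq B + singularGap A * singularGap B := by
  have hA := halfFrobSq_nonneg A
  have hB := halfFrobSq_nonneg B
  have hAB := halfFrobSq_nonneg (A * B)
  have kA := singularGap_nonneg A
  have kB := singularGap_nonneg B
  have kAB := singularGap_nonneg (A * B)
  have sA := singularGap_sq A
  have sB := singularGap_sq B
  have sAB := singularGap_sq (A * B)
  rw [Matrix.det_mul, norm_mul, mul_pow] at sAB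
  have key : ‖A * B‖ = ‖A‖ * ‖B‖ ↔ halfFrobSq (A * B) + singularGap (A * B) =
      (halfFrobSq A + singularGap A) * (halfFrobSq B + singularGap B) := by
    rw [← norm_sq_eq, ← norm_sq_eq, ← norm_sq_eq, ← mul_pow,
      sq_eq_sq₀ (norm_nonneg _) (by positivity)]
  rw [key]
  generalize halfFrobSq A = a at *
  generalize halfFrobSq B = b at *
  generalize halfFrobSq (A * B) = c at *
  generalize singularGap A = x at *
  generalize singularGap B = y at *
  generalize singularGap (A * B) = z at *
  generalize ‖A.det‖ ^ 2 = d at *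
  generalize ‖B.det‖ ^ 2 = e at *
  obtain rfl : d = a ^ 2 - x ^ 2 := by linarith
  obtain rfl : e = b ^ 2 - y ^ 2 := by linarith
  constructor
  · intro h
    rcases eq_or_ne ((a + x) * (b + y)) 0 with h0 | h0
    · have hc : c = 0 := by linarith
      rcases mul_eq_zero.1 h0 with h1 | h1
      · have : a = 0 := by linarith
        have : x = 0 := by linarith
        simp [*]
      · have : b = 0 := by linarith
        have : y = 0 := by linarith
        simp [*]
    · have hz : z = (a + x) * (b + y) - c := by linarith
      rw [hz] at sAB
      have : (a + x) * (b + y) * (c - (a * b + x * y)) = 0 := by linear_combination -sAB / 2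
      have := (mul_eq_zero.1 this).resolve_left h0
      linarith
  · intro h
    have hz : z = a * y + x * b := by
      refine (sq_eq_sq₀ kAB (by positivity)).1 ?_
      rw [sAB, h]; ring
    rw [hz, h]; ring

end NormOfProduct

/-! ### Invariance under scaling and unitary conjugation -/

section UnitaryConjugation

variable {𝕜 : Type*} [RCLike 𝕜]

theorem norm_smul_conj {U : Mat2 𝕜} (hU : U ∈ Matrix.unitaryGroup (Fin 2) 𝕜) (γ : 𝕜)
    (A : Mat2 𝕜) : ‖γ • (U * A * Uᴴ)‖ = ‖γ‖ * ‖A‖ := by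
  have hU' : Uᴴ ∈ unitary (Mat2 𝕜) := Unitary.star_mem hU
  rw [norm_smul, CStarRing.norm_mul_mem_unitary _ hU', CStarRing.norm_mem_unitary_mul _ hU]

/-- Norm-multiplicativity of a pair is unchanged by unitary conjugation and scaling. -/
theorem norm_mul_eq_iff_smul_conj {U : Mat2 𝕜} (hU : U ∈ Matrix.unitaryGroup (Fin 2) 𝕜) {γ : 𝕜}
    (hγ : γ ≠ 0) (A B : Mat2 𝕜) :
    ‖(γ • (U * A * Uᴴ)) * (γ • (U * B * Uᴴ))‖ =
      ‖γ • (U * A * Uᴴ)‖ * ‖γ • (U * B * Uᴴ)‖ ↔ ‖A * B‖ = ‖A‖ * ‖B‖ := by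
  have hUU : Uᴴ * U = 1 := Matrix.mem_unitaryGroup_iff'.1 hU
  have h : (γ • (U * A * Uᴴ)) * (γ • (U * B * Uᴴ)) = (γ * γ) • (U * (A * B) * Uᴴ) := by
    rw [Matrix.smul_mul, Matrix.mul_smul, smul_smul]
    congr 1
    calc U * A * Uᴴ * (U * B * Uᴴ) = U * A * (Uᴴ * U) * B * Uᴴ := by simp only [mul_assoc]
      _ = _ := by rw [hUU]; simp only [mul_assoc, one_mul]
  have hn : ‖γ‖ * ‖γ‖ ≠ 0 := by simpa using hγ
  rw [h, norm_smul_conj hU, norm_smul_conj hU, norm_smul_conj hU, norm_mul,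
    mul_mul_mul_comm, mul_right_inj' hn]

end UnitaryConjugation

/-! ### The real case: matrices as real-linear maps of the complex plane -/

section RealCase

open scoped ComplexOrder ComplexConjugate

/-- The matrix of the real-linear map `z ↦ α z + β conj z` of `ℂ = ℝ²`. -/
noncomputable def matOfPair : (ℂ × ℂ) ≃ₗ[ℝ] Mat2 ℝ where
  toFun p := !![p.1.re + p.2.re, p.2.im - p.1.im; p.1.im + p.2.im, p.1.re - p.2.re]
  invFun A := (⟨(A 0 0 + A 1 1) / 2, (A 1 0 - A 0 1) / 2⟩,
    ⟨(A 0 0 - A 1 1) / 2, (A 1 0 + A 0 1) / 2⟩)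
  map_add' p q := by
    ext i j
    fin_cases i <;> fin_cases j <;> simp <;> ring
  map_smul' r p := by
    ext i j
    fin_cases i <;> fin_cases j <;> simp <;> ring
  left_inv p := by
    ext <;> simp <;> ring_nf
  right_inv A := by
    ext i j
    fin_cases i <;> fin_cases j <;> simp <;> ring

theorem matOfPair_apply (α β : ℂ) :
    matOfPair (α, β) = !![α.re + β.re, β.im - α.im; α.im + β.im, α.re - β.re] := rfl

theorem matOfPair_mul (α β α' β' : ℂ) :
    matOfPair (α, β) * matOfPair (α', β') =
      matOfPair (α * α' + β * conj β', α * β' + β * conj α') := by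
  ext i j
  fin_cases i <;> fin_cases j <;> simp [matOfPair_apply, Matrix.mul_apply, Fin.sum_univ_two] <;>
    ring

theorem matOfPair_conjTranspose (α β : ℂ) : (matOfPair (α, β))ᴴ = matOfPair (conj α, β) := by
  ext i j
  fin_cases i <;> fin_cases j <;> simp [matOfPair_apply] <;> ring

theorem matOfPair_one : matOfPair (1, 0) = 1 := by
  ext i j
  fin_cases i <;> fin_cases j <;> simp [matOfPair_apply]

theorem rotReflScale_matOfPair (c : ℝ) (α β : ℂ) :
    rotReflScale c (matOfPair (α, β)) = matOfPair (α, c * β) := by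
  ext i j
  fin_cases i <;> fin_cases j <;> simp [matOfPair_apply, rotReflScale] <;> ring

theorem halfFrobSq_matOfPair (α β : ℂ) :
    halfFrobSq (matOfPair (α, β)) = ‖α‖ ^ 2 + ‖β‖ ^ 2 := by
  simp only [← Complex.normSq_eq_norm_sq, Complex.normSq_apply, halfFrobSq, matOfPair_apply,
    Real.norm_eq_abs, sq_abs]
  simp
  ring

theorem singularGap_matOfPair (α β : ℂ) :
    singularGap (matOfPair (α, β)) = 2 * (‖α‖ * ‖β‖) := by
  have hdet : (matOfPair (α, β)).det = ‖α‖ ^ 2 - ‖β‖ ^ 2 := by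
    simp only [← Complex.normSq_eq_norm_sq, Complex.normSq_apply, matOfPair_apply,
      Matrix.det_fin_two_of]
    ring
  refine (sq_eq_sq₀ (singularGap_nonneg _) (by positivity)).1 ?_
  rw [singularGap_sq, hdet, halfFrobSq_matOfPair, Real.norm_eq_abs, sq_abs]
  ring

/-- The cross term of h(AB) is 4 Re w and the product of the gaps is 4|w|, where w = αβ̄α'β'; Re w =
|w| means w ≥ 0. -/
theorem norm_matOfPair_mul_eq_iff (α β α' β' : ℂ) :
    ‖matOfPair (α, β) * matOfPair (α', β')‖ = ‖matOfPair (α, β)‖ * ‖matOfPair (α', β')‖ ↔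
      0 ≤ α * conj β * α' * β' := by
  have h : halfFrobSq (matOfPair (α, β) * matOfPair (α', β')) =
      (‖α‖ ^ 2 + ‖β‖ ^ 2) * (‖α'‖ ^ 2 + ‖β'‖ ^ 2) + 4 * (α * conj β * α' * β').re := by
    rw [matOfPair_mul, halfFrobSq_matOfPair]
    simp only [← Complex.normSq_eq_norm_sq, Complex.normSq_apply]
    simp
    ring
  rw [norm_mul_eq_iff, h, halfFrobSq_matOfPair, halfFrobSq_matOfPair, singularGap_matOfPair,
    singularGap_matOfPair, ← Complex.re_eq_norm]
  simp only [norm_mul, RCLike.norm_conj]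
  constructor <;> intro h <;> linarith

/-- A real-linear map of `ℂ²` that preserves the relation describing norm-multiplicative pairs. -/
def PreservesPairs (S : ℂ × ℂ →ₗ[ℝ] ℂ × ℂ) : Prop :=
  ∀ p q : ℂ × ℂ, 0 ≤ p.1 * conj p.2 * q.1 * q.2 →
    0 ≤ (S p).1 * conj (S p).2 * (S q).1 * (S q).2

theorem Complex.im_eq_zero_of_sq_nonneg {z : ℂ} (h : 0 ≤ z ^ 2) : z.im = 0 := by
  rw [Complex.nonneg_iff] at h
  simp only [sq, Complex.mul_re, Complex.mul_im] at h
  obtain ⟨h1, h2⟩ := h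
  have h3 : z.re * z.im = 0 := by linarith
  rcases mul_eq_zero.1 h3 with h | h
  · rw [h] at h1; nlinarith
  · exact h

theorem Complex.nonneg_of_mul_normSq_nonneg {z w : ℂ} (hw : w ≠ 0) (h : 0 ≤ z * (conj w * w)) :
    0 ≤ z := by
  have hp : 0 < Complex.normSq w := Complex.normSq_pos.2 hw
  rw [← Complex.normSq_eq_conj_mul_self, Complex.nonneg_iff] at h
  simp only [Complex.mul_re, Complex.mul_im, Complex.ofReal_re, Complex.ofReal_im] at h
  rw [Complex.nonneg_iff]
  constructor
  · exact nonneg_of_mul_nonneg_left (by linarith [h.1]) hp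
  · have : z.im * Complex.normSq w = 0 := by linarith [h.2]
    exact ((mul_eq_zero.1 this).resolve_right hp.ne').symm

theorem LinearMap.apply_eq_re_im (φ : ℂ →ₗ[ℝ] ℂ) (z : ℂ) :
    φ z = z.re * φ 1 + z.im * φ Complex.I := by
  conv_lhs => rw [← Complex.re_add_im z]
  have h1 : (z.re : ℂ) = z.re • (1 : ℂ) := by simp
  have h2 : (z.im : ℂ) * Complex.I = z.im • Complex.I := by simp
  rw [h1, h2, map_add, map_smul, map_smul]
  simp

theorem LinearMap.eq_zero_or_eq_zero_of_mul (p q : ℂ →ₗ[ℝ] ℂ) (h : ∀ x, p x * q x = 0) :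
    p = 0 ∨ q = 0 := by
  by_contra! hpq
  obtain ⟨x, hx⟩ := DFunLike.ne_iff.1 hpq.1
  obtain ⟨y, hy⟩ := DFunLike.ne_iff.1 hpq.2
  have hqx : q x = 0 := (mul_eq_zero.1 (h x)).resolve_left hx
  have hpy : p y = 0 := (mul_eq_zero.1 (h y)).resolve_right hy
  have := h (x + y)
  rw [map_add, map_add, hqx, hpy, add_zero, zero_add] at this
  exact (mul_ne_zero hx hy) this

/-- A degenerate p pairs with everything, hence by surjectivity so does its image; pairing that
image with (1, 1) and (1, -1) makes a number and its negative both nonnegative. -/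
theorem PreservesPairs.mul_eq_zero {S : ℂ × ℂ →ₗ[ℝ] ℂ × ℂ} (hS : Function.Surjective S)
    (h : PreservesPairs S) {p : ℂ × ℂ} (hp : p.1 * p.2 = 0) : (S p).1 * (S p).2 = 0 := by
  have hp' : p.1 * conj p.2 = 0 := by
    rcases _root_.mul_eq_zero.1 hp with h | h <;> simp [h]
  obtain ⟨q, hq⟩ := hS (1, 1)
  obtain ⟨r, hr⟩ := hS (1, -1)
  have h1 := h p q (by rw [hp']; simp)
  have h2 := h p r (by rw [hp']; simp)
  rw [hq] at h1
  rw [hr] at h2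
  simp only [mul_one, mul_neg] at h1 h2
  have h3 := le_antisymm (neg_nonneg.1 h2) h1
  rcases _root_.mul_eq_zero.1 h3 with h | h
  · rw [h, zero_mul]
  · rw [(map_eq_zero _).1 h, mul_zero]

/-- The diagonal case: both maps are multiplications, or both are multiplications composed with
conjugation. -/
theorem diagonal_preservesPairs {φ ψ : ℂ →ₗ[ℝ] ℂ} (hφ : Function.Injective φ)
    (hψ : Function.Injective ψ)
    (h : ∀ α β α' β' : ℂ, 0 ≤ α * conj β * α' * β' →
      0 ≤ φ α * conj (ψ β) * φ α' * ψ β') :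
    ∃ a : ℝ, a ≠ 0 ∧ ∃ b : ℂ, b ≠ 0 ∧
      ((∀ z, φ z = a * z ∧ ψ z = b * z) ∨ (∀ z, φ z = a * conj z ∧ ψ z = b * conj z)) := by
  have hψ0 : ∀ β, β ≠ 0 → ψ β ≠ 0 := fun β hβ => (map_ne_zero_iff ψ hψ).2 hβ
  have hφ0 : ∀ β, β ≠ 0 → φ β ≠ 0 := fun β hβ => (map_ne_zero_iff φ hφ).2 hβ
  have h1 : (φ 1).im = 0 := by
    apply Complex.im_eq_zero_of_sq_nonneg
    apply Complex.nonneg_of_mul_normSq_nonneg (hψ0 1 one_ne_zero)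
    convert h 1 1 1 1 (by simp) using 1
    ring
  have hI : (φ Complex.I).re = 0 := by
    have : (Complex.I * φ Complex.I).im = 0 := by
      apply Complex.im_eq_zero_of_sq_nonneg
      apply Complex.nonneg_of_mul_normSq_nonneg (hψ0 1 one_ne_zero)
      convert h Complex.I 1 Complex.I (-1) (by simp) using 1
      rw [map_neg, mul_pow, Complex.I_sq]
      ring
    simpa using this
  set a := (φ 1).re with ha
  set k := (φ Complex.I).im with hk
  have e1 : φ 1 = a := Complex.ext (by simp [ha]) (by simp [h1])
  have eI : φ Complex.I = k * Complex.I := Complex.ext (by simp [hI]) (by simp [hk])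
  have ha0 : a ≠ 0 := by
    intro h0
    exact hφ0 1 one_ne_zero (by rw [e1, h0]; simp)
  -- Since (1 ∓ i)² = ∓2i, taking α = α' = 1 ∓ i and β' = ±iβ makes the test product 2|β|².
  have key : ∀ β, 0 ≤ (a - k * Complex.I) ^ 2 * (conj (ψ β) * ψ (Complex.I * β)) ∧
      0 ≤ -((a + k * Complex.I) ^ 2 * (conj (ψ β) * ψ (Complex.I * β))) := by
    intro β
    have hb : 0 ≤ 2 * (conj β * β) := by
      rw [← Complex.normSq_eq_conj_mul_self]
      exact mul_nonneg (by norm_num) (by exact_mod_cast Complex.normSq_nonneg β)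
    constructor
    · have := h (1 - Complex.I) β (1 - Complex.I) (Complex.I * β) (by
        convert hb using 1
        linear_combination (-2 * conj β * β + conj β * β * Complex.I) * Complex.I_sq)
      rw [map_sub, e1, eI] at this
      convert this using 1
      ring
    · have := h (1 + Complex.I) β (1 + Complex.I) (-(Complex.I * β)) (by
        convert hb using 1
        linear_combination (-2 * conj β * β - conj β * β * Complex.I) * Complex.I_sq)
      rw [map_add, e1, eI, map_neg] at this
      convert this using 1
      ring
  simp only [Complex.nonneg_iff] at key
  have key2 : ∀ β, β ≠ 0 → (k = a ∨ k = -a) ∧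
      ∃ r : ℝ, 0 < r ∧ a * ψ (Complex.I * β) = r * k * Complex.I * ψ β := by
    intro β hβ
    have hw : conj (ψ β) * ψ (Complex.I * β) ≠ 0 :=
      mul_ne_zero ((map_ne_zero _).2 (hψ0 β hβ))
        (hψ0 _ (mul_ne_zero Complex.I_ne_zero hβ))
    have hk := key β
    -- The imaginary parts of the two conditions in `key` vanish; their sum and difference make w
    -- purely imaginary and k² = a².
    set w := conj (ψ β) * ψ (Complex.I * β) with hwdef
    simp only [sq, Complex.mul_re, Complex.mul_im, Complex.sub_re, Complex.sub_im,
      Complex.add_re, Complex.add_im, Complex.neg_re, Complex.neg_im, Complex.ofReal_re,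
      Complex.ofReal_im, Complex.I_re, Complex.I_im] at hk
    obtain ⟨⟨k1, k2⟩, k3, k4⟩ := hk
    ring_nf at k1 k2 k3 k4
    have hre : w.re * (a * k) = 0 ∧ w.im * (a ^ 2 - k ^ 2) = 0 := by
      constructor <;> linarith
    have hk0 : k ≠ 0 := by
      intro h0
      exact hφ0 Complex.I Complex.I_ne_zero (by rw [eI, h0]; simp)
    have hwre : w.re = 0 := (mul_eq_zero.1 hre.1).resolve_right (mul_ne_zero ha0 hk0)
    have hwim : w.im ≠ 0 := fun h0 => hw (Complex.ext hwre h0)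
    have hak : a ^ 2 - k ^ 2 = 0 := (mul_eq_zero.1 hre.2).resolve_left hwim
    refine ⟨?_, a * w.im / (k * Complex.normSq (ψ β)), ?_, ?_⟩
    · exact sq_eq_sq_iff_eq_or_eq_neg.1 (by linarith)
    · have hpos : 0 ≤ a * k * w.im := by rw [hwre] at k1; nlinarith
      have hpos' : 0 < a * k * w.im :=
        lt_of_le_of_ne hpos (mul_ne_zero (mul_ne_zero ha0 hk0) hwim).symm
      have hn := Complex.normSq_pos.2 (hψ0 β hβ)
      have : a * w.im / (k * Complex.normSq (ψ β)) =
          (a * k * w.im) / (k ^ 2 * Complex.normSq (ψ β)) := by field_simp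
      rw [this]
      positivity
    · have hww : w = w.im * Complex.I := Complex.ext (by simp [hwre]) (by simp)
      have hn : (Complex.normSq (ψ β) : ℂ) ≠ 0 := by
        exact_mod_cast (Complex.normSq_pos.2 (hψ0 β hβ)).ne'
      have hkc : (k : ℂ) ≠ 0 := by exact_mod_cast hk0
      have hcc : conj (ψ β) ≠ 0 := (map_ne_zero _).2 (hψ0 β hβ)
      have hnn := Complex.normSq_eq_conj_mul_self (z := ψ β)
      push_cast
      field_simp
      rw [hnn]
      have e : conj (ψ β) * ψ (Complex.I * β) = w.im * Complex.I := hww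
      linear_combination (ψ β) * e
  obtain ⟨r, hr, er⟩ := (key2 1 one_ne_zero).2
  have h1I : (1 + Complex.I : ℂ) ≠ 0 := by
    intro h0; simpa using congrArg Complex.re h0
  obtain ⟨s, hs, es⟩ := (key2 (1 + Complex.I) h1I).2
  have hcase := (key2 1 one_ne_zero).1
  have hb0 := hψ0 1 one_ne_zero
  have haC : (a : ℂ) ≠ 0 := by exact_mod_cast ha0
  have eI1 : Complex.I * (1 + Complex.I) = Complex.I - 1 := by
    linear_combination Complex.I_sq
  rw [mul_one] at er
  rw [eI1, map_sub, map_add] at es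
  -- So far r and s may depend on β. Additivity of ψ links β = 1 to β = 1 + i and yields r = s and
  -- rs = 1.
  have hrs : r = 1 ∧ a * ψ Complex.I = k * Complex.I * ψ 1 := by
    have hk2 : (k : ℂ) ^ 2 = a ^ 2 := by
      rcases hcase with h | h
      · rw [h]
      · rw [h]; push_cast; ring
    have hz : ψ 1 * a * ((r - s) * k * Complex.I - a * (1 - r * s)) = 0 := by
      linear_combination a * es - (a - s * k * Complex.I) * er + s * r * Complex.I ^ 2 * ψ 1 * hk2
        + s * r * a ^ 2 * ψ 1 * Complex.I_sq
    have hz' := (mul_eq_zero.1 hz).resolve_left (mul_ne_zero hb0 haC)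
    have hre := congrArg Complex.re hz'
    have him := congrArg Complex.im hz'
    simp at hre him
    have hk0 : k ≠ 0 := by
      rcases hcase with h | h <;> rw [h] <;> simpa using ha0
    have hrs : r = s := by
      rcases him with h | h
      · linarith
      · exact absurd h hk0
    have h1 : 1 - r * s = 0 := hre.resolve_left ha0
    have hr1 : r = 1 := by rw [← hrs] at h1; nlinarith
    refine ⟨hr1, ?_⟩
    rw [er, hr1]; simp
  obtain ⟨-, er⟩ := hrs
  refine ⟨a, ha0, ψ 1, hb0, ?_⟩
  rcases hcase with h | h
  · left
    intro z
    have hψI : ψ Complex.I = Complex.I * ψ 1 := by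
      rw [h] at er
      exact mul_left_cancel₀ haC (by rw [er]; ring)
    rw [φ.apply_eq_re_im, ψ.apply_eq_re_im, e1, eI, hψI, h]
    constructor
    · conv_rhs => rw [← Complex.re_add_im z]
      ring
    · conv_rhs => rw [← Complex.re_add_im z]
      ring
  · right
    intro z
    have hψI : ψ Complex.I = -(Complex.I * ψ 1) := by
      rw [h] at er
      push_cast at er
      exact mul_left_cancel₀ haC (by rw [er]; ring)
    have hc : conj z = z.re - z.im * Complex.I := by
      apply Complex.ext <;> simp
    rw [φ.apply_eq_re_im, ψ.apply_eq_re_im, e1, eI, hψI, h, hc]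
    push_cast
    constructor <;> ring

theorem PreservesPairs.exists_form {S : ℂ × ℂ →ₗ[ℝ] ℂ × ℂ} (hS : Function.Bijective S)
    (h : PreservesPairs S) :
    ∃ a : ℝ, a ≠ 0 ∧ ∃ b : ℂ, b ≠ 0 ∧
      ((∀ α β, S (α, β) = (a * α, b * β)) ∨ (∀ α β, S (α, β) = (a * conj α, b * conj β))) := by
  set p₁ : ℂ →ₗ[ℝ] ℂ := LinearMap.fst ℝ ℂ ℂ ∘ₗ S ∘ₗ LinearMap.inl ℝ ℂ ℂ with hp₁
  set q₁ : ℂ →ₗ[ℝ] ℂ := LinearMap.snd ℝ ℂ ℂ ∘ₗ S ∘ₗ LinearMap.inl ℝ ℂ ℂ with hq₁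
  set p₂ : ℂ →ₗ[ℝ] ℂ := LinearMap.fst ℝ ℂ ℂ ∘ₗ S ∘ₗ LinearMap.inr ℝ ℂ ℂ with hp₂
  set q₂ : ℂ →ₗ[ℝ] ℂ := LinearMap.snd ℝ ℂ ℂ ∘ₗ S ∘ₗ LinearMap.inr ℝ ℂ ℂ with hq₂
  have hSab : ∀ α β, S (α, β) = (p₁ α + p₂ β, q₁ α + q₂ β) := by
    intro α β
    have : ((α, β) : ℂ × ℂ) = (α, 0) + (0, β) := by simp
    rw [this, map_add]
    rfl
  have h1 : p₁ = 0 ∨ q₁ = 0 := LinearMap.eq_zero_or_eq_zero_of_mul _ _ fun x =>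
    h.mul_eq_zero hS.2 (p := (x, 0)) (by simp)
  have h2 : p₂ = 0 ∨ q₂ = 0 := LinearMap.eq_zero_or_eq_zero_of_mul _ _ fun x =>
    h.mul_eq_zero hS.2 (p := (0, x)) (by simp)
  rcases h1 with h1 | h1 <;> rcases h2 with h2 | h2
  · obtain ⟨⟨α, β⟩, hx⟩ := hS.2 (1, 0)
    rw [hSab, h1, h2] at hx
    simp at hx
  -- Blocks swapped: (1, β) pairs with itself, so (p₂ β)² ≥ 0 for every β, and the first coordinate
  -- takes only real values.
  · exfalso
    have hreal : ∀ β, (p₂ β).im = 0 := by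
      intro β
      have hq : q₁ 1 ≠ 0 := by
        intro h0
        have := @hS.1 (1, 0) (0, 0) (by rw [hSab, hSab, h1, h2, h0]; simp)
        simp at this
      apply Complex.im_eq_zero_of_sq_nonneg
      apply Complex.nonneg_of_mul_normSq_nonneg hq
      have := h (1, β) (1, β) (by
        simp only [one_mul, mul_one, ← Complex.normSq_eq_conj_mul_self]
        exact_mod_cast Complex.normSq_nonneg β)
      rw [hSab, h1, h2] at this
      convert this using 1
      simp
      ring
    obtain ⟨⟨α, β⟩, hx⟩ := hS.2 (Complex.I, 0)
    rw [hSab, h1, h2] at hx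
    have := congrArg (fun z => z.1.im) hx
    simp [hreal] at this
  · have hφ : Function.Injective p₁ := by
      intro x y hxy
      have := @hS.1 (x, 0) (y, 0) (by rw [hSab, hSab, h1, h2, hxy]; simp)
      simpa using this
    have hψ : Function.Injective q₂ := by
      intro x y hxy
      have := @hS.1 (0, x) (0, y) (by rw [hSab, hSab, h1, h2, hxy]; simp)
      simpa using this
    obtain ⟨a, ha, b, hb, hab⟩ := diagonal_preservesPairs hφ hψ (fun α β α' β' hn => by
      have := h (α, β) (α', β') hn
      rw [hSab, hSab, h1, h2] at this
      simpa using this)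
    refine ⟨a, ha, b, hb, hab.imp ?_ ?_⟩
    all_goals
      intro hz α β
      rw [hSab, h1, h2, (hz α).1, (hz β).2]
      simp
  · obtain ⟨⟨α, β⟩, hx⟩ := hS.2 (0, 1)
    rw [hSab, h1, h2] at hx
    simp at hx

/-- The real case of the classification. -/
theorem preservesNormMulPairs_real_iff (T : Mat2 ℝ →ₗ[ℝ] Mat2 ℝ) (hT : Function.Bijective T) :
    PreservesNormMulPairs T ↔
      ∃ γ : ℝ, γ ≠ 0 ∧ ∃ c : ℝ, 0 < c ∧ ∃ U ∈ Matrix.unitaryGroup (Fin 2) ℝ,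
        ∀ A : Mat2 ℝ, T A = γ • (U * rotReflScale c A * Uᴴ) := by
  constructor
  · intro h
    set S : ℂ × ℂ →ₗ[ℝ] ℂ × ℂ := matOfPair.symm.toLinearMap ∘ₗ T ∘ₗ matOfPair.toLinearMap with hSdef
    have hTS : ∀ α β, T (matOfPair (α, β)) = matOfPair (S (α, β)) := by
      intro α β; simp [hSdef]
    have hS : Function.Bijective S := by
      simpa [hSdef] using hT
    have hP : PreservesPairs S := by
      rintro ⟨α, β⟩ ⟨α', β'⟩ hp
      have := h _ _ ((norm_matOfPair_mul_eq_iff α β α' β').2 hp)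
      rw [hTS, hTS] at this
      exact (norm_matOfPair_mul_eq_iff _ _ _ _).1 this
    obtain ⟨a, ha, b, hb, hab⟩ := hP.exists_form hS
    have haC : (a : ℂ) ≠ 0 := by exact_mod_cast ha
    have hc : 0 < ‖b / a‖ := norm_pos_iff.2 (div_ne_zero hb haC)
    have hcC : ((‖b / a‖ : ℝ) : ℂ) ≠ 0 := by exact_mod_cast hc.ne'
    -- Conjugation by the rotation u multiplies β by u² and fixes α, so a square root of the phase
    -- of b / a is needed. The reflection (0, u) also conjugates both coordinates.
    obtain ⟨u, hu⟩ := IsAlgClosed.exists_pow_nat_eq (b / a / (‖b / a‖ : ℝ)) (n := 2) (by norm_num)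
    have hun : ‖u‖ = 1 := by
      have : ‖u‖ ^ 2 = 1 := by
        rw [← norm_pow, hu, norm_div, Complex.norm_real, norm_norm, div_self hc.ne']
      exact (pow_eq_one_iff_of_nonneg (norm_nonneg _) two_ne_zero).1 this
    have huu : conj u * u = 1 := by
      rw [Complex.conj_mul', hun]; simp
    have hb' : a * (u ^ 2 * (‖b / a‖ : ℝ)) = b := by
      rw [hu]; field_simp
    refine ⟨a, ha, ‖b / a‖, hc, ?_⟩
    have hform : ∀ α β : ℂ, a • matOfPair (α, β) = matOfPair (a * α, a * β) := by
      intro α β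
      rw [← map_smul]
      simp
    rcases hab with hab | hab
    · refine ⟨matOfPair (u, 0), ?_, ?_⟩
      · rw [Matrix.mem_unitaryGroup_iff', Matrix.star_eq_conjTranspose, matOfPair_conjTranspose,
          matOfPair_mul, ← matOfPair_one]
        simp [huu]
      · intro A
        obtain ⟨⟨α, β⟩, rfl⟩ := matOfPair.surjective A
        rw [hTS, hab, rotReflScale_matOfPair, matOfPair_conjTranspose, matOfPair_mul,
          matOfPair_mul, hform]
        congr 2
        · simp only [map_zero, mul_zero, zero_mul, add_zero]
          linear_combination (-a * α) * huu
        · simp only [mul_zero, zero_mul, add_zero, zero_add, Complex.conj_conj]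
          linear_combination (-β) * hb'
    · refine ⟨matOfPair (0, u), ?_, ?_⟩
      · rw [Matrix.mem_unitaryGroup_iff', Matrix.star_eq_conjTranspose, matOfPair_conjTranspose,
          matOfPair_mul, ← matOfPair_one]
        simp [huu, mul_comm u]
      · intro A
        obtain ⟨⟨α, β⟩, rfl⟩ := matOfPair.surjective A
        rw [hTS, hab, rotReflScale_matOfPair, matOfPair_conjTranspose, matOfPair_mul,
          matOfPair_mul, hform]
        congr 2
        · simp only [map_zero, map_mul, mul_zero, zero_mul, zero_add]
          linear_combination (-a * conj α) * huu
        · simp only [map_zero, map_mul, mul_zero, zero_mul, add_zero, zero_add, Complex.conj_ofReal]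
          linear_combination (-conj β) * hb'
  · rintro ⟨γ, hγ, c, hc, U, hU, hform⟩ A B hAB
    rw [hform, hform, norm_mul_eq_iff_smul_conj hU hγ]
    obtain ⟨⟨α, β⟩, rfl⟩ := matOfPair.surjective A
    obtain ⟨⟨α', β'⟩, rfl⟩ := matOfPair.surjective B
    rw [norm_matOfPair_mul_eq_iff] at hAB
    rw [rotReflScale_matOfPair, rotReflScale_matOfPair, norm_matOfPair_mul_eq_iff]
    have hcc : (0 : ℂ) ≤ ((c * c : ℝ) : ℂ) := by exact_mod_cast (mul_pos hc hc).le
    convert mul_nonneg hcc hAB using 1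
    simp
    ring

end RealCase

/-! ### Quaternion maps preserving the ray condition -/

section QuaternionMaps

open scoped Quaternion

/-- The quaternion unit `i`. -/
def quatI : ℍ[ℝ] := ⟨0, 1, 0, 0⟩

/-- The quaternion unit `j`. -/
def quatJ : ℍ[ℝ] := ⟨0, 0, 1, 0⟩

/-- The quaternion unit `k`. -/
def quatK : ℍ[ℝ] := ⟨0, 0, 0, 1⟩

@[simp] theorem quatI_re : quatI.re = 0 := rfl
@[simp] theorem quatI_imI : quatI.imI = 1 := rfl
@[simp] theorem quatI_imJ : quatI.imJ = 0 := rfl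
@[simp] theorem quatI_imK : quatI.imK = 0 := rfl
@[simp] theorem quatJ_re : quatJ.re = 0 := rfl
@[simp] theorem quatJ_imI : quatJ.imI = 0 := rfl
@[simp] theorem quatJ_imJ : quatJ.imJ = 1 := rfl
@[simp] theorem quatJ_imK : quatJ.imK = 0 := rfl
@[simp] theorem quatK_re : quatK.re = 0 := rfl
@[simp] theorem quatK_imI : quatK.imI = 0 := rfl
@[simp] theorem quatK_imJ : quatK.imJ = 0 := rfl
@[simp] theorem quatK_imK : quatK.imK = 1 := rfl

theorem quat_eq_basis (x : ℍ[ℝ]) :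
    x = x.re • (1 : ℍ[ℝ]) + x.imI • quatI + x.imJ • quatJ + x.imK • quatK := by
  ext <;> simp

theorem quatI_mul_quatI : quatI * quatI = -1 := by ext <;> simp
theorem quatJ_mul_quatJ : quatJ * quatJ = -1 := by ext <;> simp
theorem quatK_mul_quatK : quatK * quatK = -1 := by ext <;> simp
theorem quatI_mul_quatJ : quatI * quatJ = quatK := by ext <;> simp
theorem quatJ_mul_quatI : quatJ * quatI = -quatK := by ext <;> simp
theorem quatJ_mul_quatK : quatJ * quatK = quatI := by ext <;> simp
theorem quatK_mul_quatJ : quatK * quatJ = -quatI := by ext <;> simp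
theorem quatK_mul_quatI : quatK * quatI = quatJ := by ext <;> simp
theorem quatI_mul_quatK : quatI * quatK = -quatJ := by ext <;> simp

/-- A triple satisfying the relations of `i`, `j`, `k` is conjugate to it. -/
theorem exists_conj_of_relations {p q r : ℍ[ℝ]} (hpp : p * p = -1) (hqq : q * q = -1)
    (hpq : p * q = r) (hqp : q * p = -r) :
    ∃ a : ℍ[ℝ], a ≠ 0 ∧ p * a = a * quatI ∧ q * a = a * quatJ ∧ r * a = a * quatK := by
  have hpr : p * r = -q := by rw [← hpq, ← mul_assoc, hpp]; simp
  have hqr : q * r = p := by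
    have : r = -(q * p) := by rw [hqp, neg_neg]
    rw [this, mul_neg, ← mul_assoc, hqq]; simp
  -- The averaging operator of Skolem–Noether: the minus signs are the inverses of i, j, k, and
  -- every value of f intertwines the two triples.
  let f : ℍ[ℝ] → ℍ[ℝ] := fun x => x - p * (x * quatI) - q * (x * quatJ) - r * (x * quatK)
  have hp : ∀ x, p * f x = f x * quatI := by
    intro x
    simp only [f, mul_sub, sub_mul, ← mul_assoc p, hpp, hpq, hpr]
    simp only [mul_assoc, quatI_mul_quatI, quatJ_mul_quatI, quatK_mul_quatI, mul_neg, mul_one,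
      neg_mul, one_mul]
    abel
  have hq : ∀ x, q * f x = f x * quatJ := by
    intro x
    simp only [f, mul_sub, sub_mul, ← mul_assoc q, hqq, hqp, hqr]
    simp only [mul_assoc, quatI_mul_quatJ, quatJ_mul_quatJ, quatK_mul_quatJ, mul_neg, mul_one,
      neg_mul, one_mul]
    abel
  have hr : ∀ x, r * f x = f x * quatK := by
    intro x
    rw [← hpq, mul_assoc, hq, ← mul_assoc, hp, mul_assoc, quatI_mul_quatJ]
  -- Shows that f is not identically zero: Σ e y e⁻¹ over the four units e is 4 Re y, so only the
  -- first term of f survives.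
  have hsum : f 1 - f quatI * quatI - f quatJ * quatJ - f quatK * quatK = 4 := by
    simp only [f, sub_mul, mul_assoc, one_mul, quatI_mul_quatI, quatJ_mul_quatI, quatK_mul_quatI,
      quatI_mul_quatJ, quatJ_mul_quatJ, quatK_mul_quatJ, quatI_mul_quatK, quatJ_mul_quatK,
      quatK_mul_quatK, mul_neg, neg_mul, mul_one]
    norm_num
    abel_nf
    norm_num
  have hex : ∃ x, f x ≠ 0 := by
    by_contra! h0
    simp only [h0, zero_mul, sub_zero] at hsum
    have h4 : (0 : ℝ) = 4 := congrArg QuaternionAlgebra.re hsum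
    norm_num at h4
  obtain ⟨x, hx⟩ := hex
  exact ⟨f x, hx, hp x, hq x, hr x⟩

/-- The cross product of the imaginary parts, and the relation between the real parts, read off
from two proportionality conditions. -/
theorem cross_eq_smul_of_sameRay {a b G : ℍ[ℝ]} (hG : G.im ≠ 0)
    (h₁ : SameRay ℝ G.im (b * star a).im) (h₂ : SameRay ℝ (star b * a).im G.im) :
    (∃ s : ℝ, (a.im * b.im).im = s • G.im) ∧ a.re • b.im = b.re • a.im := by
  obtain ⟨s, hs, h₁⟩ := h₁.exists_nonneg_left hG
  obtain ⟨t, ht, h₂⟩ := h₂.symm.exists_nonneg_left hG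
  -- With vector parts a, b and real parts a₀, b₀, the two given vectors are a × b ± (a₀b - b₀a).
  -- These summands are orthogonal, yet both are multiples of G; since s, t ≥ 0, the second
  -- vanishes.
  have hC : (2 : ℝ) • (a.im * b.im).im = (s + t) • G.im := by
    rw [add_smul, h₁, h₂]
    ext <;> simp <;> ring
  have hD : (2 : ℝ) • (a.re • b.im - b.re • a.im) = (s - t) • G.im := by
    rw [sub_smul, h₁, h₂]
    ext <;> simp <;> ring
  refine ⟨⟨(s + t) / 2, ?_⟩, ?_⟩
  · rw [div_eq_inv_mul, mul_smul, ← hC, smul_smul]; norm_num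
  · have horth : (s + t) * (s - t) * (G.imI ^ 2 + G.imJ ^ 2 + G.imK ^ 2) = 0 := by
      have c1 := congrArg QuaternionAlgebra.imI hC
      have c2 := congrArg QuaternionAlgebra.imJ hC
      have c3 := congrArg QuaternionAlgebra.imK hC
      have d1 := congrArg QuaternionAlgebra.imI hD
      have d2 := congrArg QuaternionAlgebra.imJ hD
      have d3 := congrArg QuaternionAlgebra.imK hD
      simp at c1 c2 c3 d1 d2 d3
      have e : (s + t) * (s - t) * (G.imI ^ 2 + G.imJ ^ 2 + G.imK ^ 2) =
          ((s + t) * G.imI) * ((s - t) * G.imI) + ((s + t) * G.imJ) * ((s - t) * G.imJ) +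
          ((s + t) * G.imK) * ((s - t) * G.imK) := by ring
      rw [e, ← c1, ← c2, ← c3, ← d1, ← d2, ← d3]
      ring
    have hGn : G.imI ^ 2 + G.imJ ^ 2 + G.imK ^ 2 ≠ 0 := by
      intro h0
      apply hG
      have g1 : G.imI = 0 := by nlinarith [sq_nonneg G.imI, sq_nonneg G.imJ, sq_nonneg G.imK]
      have g2 : G.imJ = 0 := by nlinarith [sq_nonneg G.imI, sq_nonneg G.imJ, sq_nonneg G.imK]
      have g3 : G.imK = 0 := by nlinarith [sq_nonneg G.imI, sq_nonneg G.imJ, sq_nonneg G.imK]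
      ext <;> simp [g1, g2, g3]
    have hst : s - t = 0 := by
      rcases mul_eq_zero.1 ((mul_eq_zero.1 horth).resolve_right hGn) with h | h
      · linarith
      · exact h
    rw [hst, zero_smul] at hD
    exact sub_eq_zero.1 ((smul_eq_zero.1 hD).resolve_left two_ne_zero)

/-- A linear map of the quaternions preserves the relation between pairs of planes that describes
norm-multiplicative pairs. -/
def PreservesPlanePairs (φ : ℍ[ℝ] →ₗ[ℝ] ℍ[ℝ]) : Prop :=
  ∀ X Y X' Y' : ℍ[ℝ], SameRay ℝ (star X * Y).im (Y' * star X').im →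
    SameRay ℝ (star (φ X) * φ Y).im (φ Y' * star (φ X')).im

theorem PreservesPlanePairs.smul {φ : ℍ[ℝ] →ₗ[ℝ] ℍ[ℝ]} (h : PreservesPlanePairs φ) (c : ℝ) :
    PreservesPlanePairs (c • φ) := by
  intro X Y X' Y' hr
  have := (h X Y X' Y' hr).map ((c * c) • (LinearMap.id : ℍ[ℝ] →ₗ[ℝ] ℍ[ℝ]))
  simp only [LinearMap.smul_apply, LinearMap.id_apply, Quaternion.star_smul, smul_mul_smul_comm,
    Quaternion.im_smul] at this ⊢
  exact this

/-- The pair (1, y) matches itself. Choosing φ(y) = wφ(1) with w imaginary gives two vectors of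
equal norm on one ray, hence equal, which says that w commutes with φ(1). -/
theorem PreservesPlanePairs.apply_one_im {φ : ℍ[ℝ] →ₗ[ℝ] ℍ[ℝ]} (hφ : Function.Surjective φ)
    (h : PreservesPlanePairs φ) : (φ 1).im = 0 := by
  have hcomm : ∀ w : ℍ[ℝ], w.re = 0 → φ 1 * w = w * φ 1 := by
    intro w hw
    rcases eq_or_ne (φ 1) 0 with h0 | h0
    · simp [h0]
    obtain ⟨y, hy⟩ := hφ (w * φ 1)
    have h1 := h 1 y 1 y (by simp [SameRay.rfl])
    rw [hy] at h1
    have e1 : (star (φ 1) * (w * φ 1)).im = star (φ 1) * (w * φ 1) := by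
      ext <;> simp [hw]
      ring
    have e2 : (w * φ 1 * star (φ 1)).im = w * φ 1 * star (φ 1) := by
      ext <;> simp [hw]
      ring
    rw [e1, e2, sameRay_iff_of_norm_eq] at h1
    · have hc : w * φ 1 * star (φ 1) = star (φ 1) * (φ 1 * w) := by
        rw [mul_assoc, Quaternion.self_mul_star, ← mul_assoc, Quaternion.star_mul_self]
        exact (Quaternion.coe_commutes _ _).symm
      rw [hc] at h1
      exact (mul_left_cancel₀ (star_ne_zero.2 h0) h1).symm
    · simp only [norm_mul, Quaternion.norm_star]; ring
  have hI := hcomm quatI rfl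
  have hJ := hcomm quatJ rfl
  have i2 := congrArg QuaternionAlgebra.imJ hI
  have i3 := congrArg QuaternionAlgebra.imK hI
  have j3 := congrArg QuaternionAlgebra.imK hJ
  simp at i2 i3 j3
  ext <;> simp <;> linarith

/-- If z = x × y, the plane of 1 and z matches that of x and y in either order, so the images of i,
j, k satisfy the cross product rules up to scalars. Further test planes force all these scalars to
be 1. -/
theorem PreservesPlanePairs.relations {φ : ℍ[ℝ] →ₗ[ℝ] ℍ[ℝ]} (hφ : Function.Injective φ)
    (h : PreservesPlanePairs φ) (h1 : φ 1 = 1) :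
    (φ quatI).re = 0 ∧ (φ quatJ).re = 0 ∧ (φ quatK).re = 0 ∧
      (φ quatI * φ quatJ).im = φ quatK ∧ (φ quatJ * φ quatK).im = φ quatI ∧
      (φ quatK * φ quatI).im = φ quatJ := by
  have him : ∀ z : ℍ[ℝ], (φ z).im = 0 → z.im = 0 := by
    intro z hz
    have h2 : φ z = φ ((φ z).re • (1 : ℍ[ℝ])) := by
      rw [map_smul, h1]
      conv_lhs => rw [← Quaternion.re_add_im (φ z), hz, add_zero]
      ext <;> simp
    have h3 := hφ h2
    rw [h3]
    ext <;> simp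
  have cross : ∀ x y z : ℍ[ℝ], x.re = 0 → y.re = 0 → (x * y).im = z → z ≠ 0 →
      (∃ s : ℝ, ((φ x).im * (φ y).im).im = s • (φ z).im) ∧
        (φ x).re • (φ y).im = (φ y).re • (φ x).im := by
    intro x y z hx hy hz hz0
    have hzi : z.im = z := by rw [← hz, Quaternion.im_idem]
    apply cross_eq_smul_of_sameRay
    · intro h0
      exact hz0 (hzi ▸ him z h0)
    · have := h 1 z x y (by
        have : (y * star x).im = z := by
          rw [← hz]; ext <;> simp [hx, hy] <;> ring
        rw [this]; simp [hzi, SameRay.rfl])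
      simpa [h1] using this
    · have := h y x 1 z (by
        have : (star y * x).im = z := by
          rw [← hz]; ext <;> simp [hx, hy] <;> ring
        rw [this]; simp [hzi, SameRay.rfl])
      simpa [h1] using this
  have indep : ∀ a b c : ℝ, a • (φ quatI).im + b • (φ quatJ).im + c • (φ quatK).im = 0 →
      a = 0 ∧ b = 0 ∧ c = 0 := by
    intro a b c habc
    have := him (a • quatI + b • quatJ + c • quatK) (by
      simpa using habc)
    have e1 := congrArg QuaternionAlgebra.imI this
    have e2 := congrArg QuaternionAlgebra.imJ this
    have e3 := congrArg QuaternionAlgebra.imK this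
    simpa using And.intro e1 (And.intro e2 e3)
  have hI0 : quatI ≠ 0 := fun h0 => by simpa using congrArg QuaternionAlgebra.imI h0
  have hJ0 : quatJ ≠ 0 := fun h0 => by simpa using congrArg QuaternionAlgebra.imJ h0
  have hK0 : quatK ≠ 0 := fun h0 => by simpa using congrArg QuaternionAlgebra.imK h0
  obtain ⟨⟨s₁, c1⟩, d1⟩ := cross quatI quatJ quatK rfl rfl (by ext <;> simp) hK0
  obtain ⟨⟨s₂, c2⟩, d2⟩ := cross quatJ quatK quatI rfl rfl (by ext <;> simp) hI0
  obtain ⟨⟨s₃, c3⟩, -⟩ := cross quatK quatI quatJ rfl rfl (by ext <;> simp) hJ0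
  -- k × (i + j) = j - i, and below i × (j + k) = k - j: these equate the scalars s₁, s₂, s₃.
  obtain ⟨⟨s₄, c4⟩, -⟩ := cross quatK (quatI + quatJ) (quatJ - quatI) (by simp) (by simp)
    (by ext <;> simp) (fun h0 => by simpa using congrArg QuaternionAlgebra.imJ h0)
  obtain ⟨⟨s₅, c5⟩, -⟩ := cross quatI (quatJ + quatK) (quatK - quatJ) (by simp) (by simp)
    (by ext <;> simp) (fun h0 => by simpa using congrArg QuaternionAlgebra.imK h0)
  have r1 := indep (-(φ quatJ).re) (φ quatI).re 0 (by rw [zero_smul, add_zero, d1]; simp)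
  have r2 := indep 0 (-(φ quatK).re) (φ quatJ).re (by rw [zero_smul, zero_add, d2]; simp)
  have hIre : (φ quatI).re = 0 := r1.2.1
  have hJre : (φ quatJ).re = 0 := r2.2.2
  have hKre : (φ quatK).re = 0 := neg_eq_zero.1 r2.2.1
  have iI : (φ quatI).im = φ quatI := by ext <;> simp [hIre]
  have iJ : (φ quatJ).im = φ quatJ := by ext <;> simp [hJre]
  have iK : (φ quatK).im = φ quatK := by ext <;> simp [hKre]
  -- (1 - i)j = j - k mixes a term linear in φ with a product, which fixes the common scalar at 1.
  have h6 := h (1 + quatI) quatJ 1 (quatJ - quatK) (by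
    have : (star (1 + quatI) * quatJ).im = (quatJ - quatK * star 1).im := by ext <;> simp
    rw [this]; simp [SameRay.rfl])
  simp only [map_add, map_sub, h1, Quaternion.im_sub, Quaternion.im_add, iI, iJ, iK, star_one,
    mul_one, star_add, add_mul, one_mul, mul_add] at c1 c2 c3 c4 c5 h6 indep
  have antiIK : (φ quatI * φ quatK).im = -(φ quatK * φ quatI).im := by
    ext <;> simp [hIre, hKre] <;> ring
  have hstar : (star (φ quatI) * φ quatJ).im = -(φ quatI * φ quatJ).im := by
    ext <;> simp [hIre, hJre] <;> ring
  rw [antiIK, c3, c1] at c5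
  have antiKJ : (φ quatK * φ quatJ).im = -(φ quatJ * φ quatK).im := by
    ext <;> simp [hJre, hKre] <;> ring
  rw [antiKJ, c2, c3] at c4
  have e4 := indep (-s₂ + s₄) (s₃ - s₄) 0 (by
    rw [← sub_eq_zero] at c4; rw [← c4]; module)
  have e5 := indep 0 (-s₃ + s₅) (s₁ - s₅) (by
    rw [← sub_eq_zero] at c5; rw [← c5]; module)
  rw [hstar, c1] at h6
  have hne : φ quatJ - φ quatK ≠ 0 := by
    intro h0
    have := (indep 0 1 (-1) (by rw [← h0]; module)).2.1
    norm_num at this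
  obtain ⟨t, -, ht⟩ := h6.symm.exists_nonneg_left hne
  have e6 := indep 0 (t - 1) (s₁ - t) (by
    rw [← sub_eq_zero] at ht; rw [← ht]; module)
  have hs1 : s₁ = 1 := by linarith [e6.2.1, e6.2.2]
  have hs3 : s₃ = 1 := by linarith [e5.2.1, e5.2.2]
  have hs2 : s₂ = 1 := by linarith [e4.1, e4.2.1]
  refine ⟨hIre, hJre, hKre, ?_, ?_, ?_⟩
  · rw [c1, hs1, one_smul]
  · rw [c2, hs2, one_smul]
  · rw [c3, hs3, one_smul]

/-- Three imaginary quaternions that multiply under the cross product like `i`, `j`, `k` satisfy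
the quaternion relations. -/
theorem quaternion_relations_of_cross {p q r : ℍ[ℝ]} (hp : p.re = 0) (hq : q.re = 0)
    (hr : r.re = 0) (hpq : (p * q).im = r) (hqr : (q * r).im = p) (hrp : (r * p).im = q)
    (hr0 : r ≠ 0) :
    p * p = -1 ∧ q * q = -1 ∧ p * q = r ∧ q * p = -r := by
  have a1 := congrArg QuaternionAlgebra.imI hpq
  have a2 := congrArg QuaternionAlgebra.imJ hpq
  have a3 := congrArg QuaternionAlgebra.imK hpq
  have b1 := congrArg QuaternionAlgebra.imI hqr
  have b2 := congrArg QuaternionAlgebra.imJ hqr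
  have b3 := congrArg QuaternionAlgebra.imK hqr
  have d1 := congrArg QuaternionAlgebra.imI hrp
  have d2 := congrArg QuaternionAlgebra.imJ hrp
  have d3 := congrArg QuaternionAlgebra.imK hrp
  simp [hp, hq, hr] at a1 a2 a3 b1 b2 b3 d1 d2 d3
  have opq : p.imI * q.imI + p.imJ * q.imJ + p.imK * q.imK = 0 := by
    rw [← d1, ← d2, ← d3]; ring
  have npr : p.imI * p.imI + p.imJ * p.imJ + p.imK * p.imK =
      r.imI * r.imI + r.imJ * r.imJ + r.imK * r.imK := by
    linear_combination (-p.imI) * b1 - p.imJ * b2 - p.imK * b3 + r.imI * a1 + r.imJ * a2 +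
      r.imK * a3
  have nqr : q.imI * q.imI + q.imJ * q.imJ + q.imK * q.imK =
      r.imI * r.imI + r.imJ * r.imJ + r.imK * r.imK := by
    linear_combination (-q.imI) * d1 - q.imJ * d2 - q.imK * d3 + r.imI * a1 + r.imJ * a2 +
      r.imK * a3
  have hN : 0 < r.imI * r.imI + r.imJ * r.imJ + r.imK * r.imK := by
    have := Quaternion.normSq_nonneg (a := r)
    have h0 := Quaternion.normSq_ne_zero.2 hr0
    have h1 := lt_of_le_of_ne this h0.symm
    rw [Quaternion.normSq_def', hr] at h1
    linarith
  -- Lagrange's identity for orthogonal p, q. As all three norms agree, N = N², so N = 1.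
  have hlag : (r.imI * r.imI + r.imJ * r.imJ + r.imK * r.imK) =
      (p.imI * p.imI + p.imJ * p.imJ + p.imK * p.imK) *
        (q.imI * q.imI + q.imJ * q.imJ + q.imK * q.imK) := by
    have : (p.imI * p.imI + p.imJ * p.imJ + p.imK * p.imK) *
        (q.imI * q.imI + q.imJ * q.imJ + q.imK * q.imK) =
        (p.imJ * q.imK - p.imK * q.imJ) ^ 2 + (p.imK * q.imI - p.imI * q.imK) ^ 2 +
          (p.imI * q.imJ - p.imJ * q.imI) ^ 2 +
          (p.imI * q.imI + p.imJ * q.imJ + p.imK * q.imK) ^ 2 := by ring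
    rw [this, opq, ← a1, ← a2, ← a3]
    ring
  rw [npr, nqr] at hlag
  have hN1 : r.imI * r.imI + r.imJ * r.imJ + r.imK * r.imK = 1 := by
    have := mul_left_cancel₀ hN.ne' (hlag.symm.trans (mul_one _).symm)
    exact this
  refine ⟨?_, ?_, ?_, ?_⟩
  · ext <;> simp [hp] <;> linarith
  · ext <;> simp [hq] <;> linarith
  · ext <;> simp [hp, hq, hr] <;> linarith
  · ext <;> simp [hp, hq, hr] <;> linarith

/-- The linear bijections of the quaternions that preserve the relation are the nonzero real
multiples of the conjugations by unit quaternions. -/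
theorem PreservesPlanePairs.exists_conj {φ : ℍ[ℝ] →ₗ[ℝ] ℍ[ℝ]} (hφ : Function.Bijective φ)
    (h : PreservesPlanePairs φ) :
    ∃ c : ℝ, c ≠ 0 ∧ ∃ v : ℍ[ℝ], v * star v = 1 ∧ star v * v = 1 ∧
      ∀ x, φ x = c • (v * x * star v) := by
  have him := h.apply_one_im hφ.2
  set c := (φ 1).re with hc
  have hφ1 : φ 1 = c • (1 : ℍ[ℝ]) := by
    conv_lhs => rw [← Quaternion.re_add_im (φ 1), him, add_zero]
    ext <;> simp [hc]
  have hc0 : c ≠ 0 := by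
    intro h0
    rw [h0, zero_smul] at hφ1
    exact one_ne_zero (hφ.1 (hφ1.trans (map_zero φ).symm))
  have hinj : Function.Injective (c⁻¹ • φ) := by
    intro x y hxy
    apply hφ.1
    simpa [hc0] using hxy
  have h1 : (c⁻¹ • φ) 1 = 1 := by
    rw [LinearMap.smul_apply, hφ1, smul_smul, inv_mul_cancel₀ hc0, one_smul]
  have hrel := (h.smul c⁻¹).relations hinj h1
  set ψ := c⁻¹ • φ with hψ
  obtain ⟨hp, hq, hr, hpq, hqr, hrp⟩ := hrel
  have hr0 : ψ quatK ≠ 0 := by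
    intro h0
    have := hinj (h0.trans (map_zero ψ).symm)
    simpa using congrArg QuaternionAlgebra.imK this
  obtain ⟨e1, e2, e3, e4⟩ := quaternion_relations_of_cross hp hq hr hpq hqr hrp hr0
  obtain ⟨a, ha, f1, f2, f3⟩ := exists_conj_of_relations e1 e2 e3 e4
  have hcomm : ∀ x, ψ x * a = a * x := by
    intro x
    conv_lhs => rw [quat_eq_basis x]
    conv_rhs => rw [quat_eq_basis x]
    simp only [map_add, map_smul, add_mul, mul_add, smul_mul_assoc, mul_smul_comm, f1, f2, f3, h1,
      one_mul, mul_one]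
  have hna : ‖a‖ ≠ 0 := norm_ne_zero_iff.2 ha
  have hsm : ∀ r : ℝ, (r : ℍ[ℝ]) = r • 1 := fun r => by ext <;> simp
  refine ⟨c, hc0, ‖a‖⁻¹ • a, ?_, ?_, ?_⟩
  · rw [Quaternion.star_smul, smul_mul_smul_comm, Quaternion.self_mul_star, hsm,
      Quaternion.normSq_eq_norm_mul_self, smul_smul]
    field_simp
    simp
  · rw [Quaternion.star_smul, smul_mul_smul_comm, Quaternion.star_mul_self, hsm,
      Quaternion.normSq_eq_norm_mul_self, smul_smul]
    field_simp
    simp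
  · intro x
    have hx : φ x = c • ψ x := by
      rw [hψ, LinearMap.smul_apply, smul_smul, mul_inv_cancel₀ hc0, one_smul]
    rw [hx, Quaternion.star_smul, smul_mul_assoc, smul_mul_smul_comm, ← hcomm, mul_assoc,
      Quaternion.self_mul_star, hsm, Quaternion.normSq_eq_norm_mul_self, mul_smul_comm,
      smul_smul (‖a‖⁻¹ * ‖a‖⁻¹), mul_one]
    have : ‖a‖⁻¹ * ‖a‖⁻¹ * (‖a‖ * ‖a‖) = 1 := by field_simp
    rw [this, one_smul]

end QuaternionMaps

/-! ### The complex case: complex matrices as pairs of quaternions -/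

section ComplexCase

open scoped Quaternion

/-- The embedding of the quaternions in `M₂(ℂ)` with image `quaternionSpace`. -/
noncomputable def quatMat : ℍ[ℝ] →ₗ[ℝ] Mat2 ℂ where
  toFun x := !![⟨x.re, x.imI⟩, ⟨x.imJ, x.imK⟩; ⟨-x.imJ, x.imK⟩, ⟨x.re, -x.imI⟩]
  map_add' x y := by
    ext i j
    fin_cases i <;> fin_cases j <;> apply Complex.ext <;> simp <;> ring
  map_smul' r x := by
    ext i j
    fin_cases i <;> fin_cases j <;> apply Complex.ext <;> simp

theorem quatMat_apply (x : ℍ[ℝ]) :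
    quatMat x = !![⟨x.re, x.imI⟩, ⟨x.imJ, x.imK⟩; ⟨-x.imJ, x.imK⟩, ⟨x.re, -x.imI⟩] := rfl

theorem quatMat_one : quatMat 1 = 1 := by
  ext i j
  fin_cases i <;> fin_cases j <;> apply Complex.ext <;> simp [quatMat_apply]

theorem quatMat_mul (x y : ℍ[ℝ]) : quatMat (x * y) = quatMat x * quatMat y := by
  ext i j
  fin_cases i <;> fin_cases j <;> apply Complex.ext <;>
    simp [quatMat_apply, Matrix.mul_apply, Fin.sum_univ_two] <;> ring

theorem quatMat_star (x : ℍ[ℝ]) : quatMat (star x) = (quatMat x)ᴴ := by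
  ext i j
  fin_cases i <;> fin_cases j <;> apply Complex.ext <;> simp [quatMat_apply]

theorem mem_quaternionSpace_iff {A : Mat2 ℂ} : A ∈ quaternionSpace ↔ ∃ x, quatMat x = A := by
  have h : quaternionSpace = LinearMap.range quatMat := by
    apply le_antisymm
    · rw [quaternionSpace, Submodule.span_le]
      rintro A (rfl | rfl | rfl | rfl)
      · exact ⟨1, quatMat_one⟩
      · refine ⟨quatK, ?_⟩
        ext i j
        fin_cases i <;> fin_cases j <;> apply Complex.ext <;> simp [quatMat_apply]
      · refine ⟨quatJ, ?_⟩
        ext i j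
        fin_cases i <;> fin_cases j <;> apply Complex.ext <;> simp [quatMat_apply]
      · refine ⟨quatI, ?_⟩
        ext i j
        fin_cases i <;> fin_cases j <;> apply Complex.ext <;> simp [quatMat_apply]
    · rintro _ ⟨x, rfl⟩
      have hx : quatMat x = x.re • (1 : Mat2 ℂ) + x.imK • !![0, Complex.I; Complex.I, 0] +
          x.imJ • !![0, 1; -1, 0] + x.imI • !![Complex.I, 0; 0, -Complex.I] := by
        ext i j
        fin_cases i <;> fin_cases j <;> apply Complex.ext <;> simp [quatMat_apply]
      rw [hx]
      refine add_mem (add_mem (add_mem ?_ ?_) ?_) ?_ <;>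
        exact Submodule.smul_mem _ _ (Submodule.subset_span (by simp))
  rw [h]; rfl

/-- The quaternion with given components. -/
def quatOf (a b c d : ℝ) : ℍ[ℝ] := ⟨a, b, c, d⟩

@[simp] theorem quatOf_re (a b c d : ℝ) : (quatOf a b c d).re = a := rfl
@[simp] theorem quatOf_imI (a b c d : ℝ) : (quatOf a b c d).imI = b := rfl
@[simp] theorem quatOf_imJ (a b c d : ℝ) : (quatOf a b c d).imJ = c := rfl
@[simp] theorem quatOf_imK (a b c d : ℝ) : (quatOf a b c d).imK = d := rfl

/-- The decomposition `M₂(ℂ) = V₃ ⊕ i V₃`. -/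
noncomputable def biquatMat : (ℍ[ℝ] × ℍ[ℝ]) ≃ₗ[ℝ] Mat2 ℂ where
  toFun p := quatMat p.1 + Complex.I • quatMat p.2
  invFun A :=
    (quatOf (((A 0 0).re + (A 1 1).re) / 2) (((A 0 0).im - (A 1 1).im) / 2)
      (((A 0 1).re - (A 1 0).re) / 2) (((A 0 1).im + (A 1 0).im) / 2),
    quatOf (((A 0 0).im + (A 1 1).im) / 2) (((A 1 1).re - (A 0 0).re) / 2)
      (((A 0 1).im - (A 1 0).im) / 2) (-((A 0 1).re + (A 1 0).re) / 2))
  map_add' p q := by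
    simp only [Prod.fst_add, Prod.snd_add, map_add, smul_add]; abel
  map_smul' r p := by
    simp only [Prod.smul_fst, Prod.smul_snd, map_smul, smul_add, RingHom.id_apply,
      smul_comm Complex.I r]
  left_inv p := by
    apply Prod.ext <;> apply Quaternion.ext <;> simp [quatMat_apply] <;> ring
  right_inv A := by
    ext i j
    fin_cases i <;> fin_cases j <;> apply Complex.ext <;> simp [quatMat_apply] <;> ring

theorem biquatMat_apply (X Y : ℍ[ℝ]) :
    biquatMat (X, Y) = quatMat X + Complex.I • quatMat Y := rfl

theorem biquatMat_zero_right (X : ℍ[ℝ]) : biquatMat (X, 0) = quatMat X := by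
  simp [biquatMat_apply]

theorem quatMat_add_smul (X Y : ℍ[ℝ]) (μ : ℂ) :
    quatMat X + μ • quatMat Y = biquatMat (X + μ.re • Y, μ.im • Y) := by
  conv_lhs => rw [← Complex.re_add_im μ]
  rw [biquatMat_apply, map_add, map_smul, map_smul, add_smul, mul_comm, mul_smul,
    ← Complex.coe_smul, ← Complex.coe_smul, add_assoc]

theorem halfFrobSq_biquatMat (X Y : ℍ[ℝ]) :
    halfFrobSq (biquatMat (X, Y)) = Quaternion.normSq X + Quaternion.normSq Y := by
  simp only [halfFrobSq, ← Complex.normSq_eq_norm_sq, Complex.normSq_apply, Quaternion.normSq_def',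
    biquatMat_apply, quatMat_apply]
  simp
  ring

theorem singularGap_biquatMat (X Y : ℍ[ℝ]) :
    singularGap (biquatMat (X, Y)) = 2 * ‖(star X * Y).im‖ := by
  refine (sq_eq_sq₀ (singularGap_nonneg _) (by positivity)).1 ?_
  rw [singularGap_sq, halfFrobSq_biquatMat, mul_pow, sq ‖(star X * Y).im‖,
    ← Quaternion.normSq_eq_norm_mul_self, ← Complex.normSq_eq_norm_sq]
  simp only [Complex.normSq_apply, Quaternion.normSq_def', biquatMat_apply, quatMat_apply,
    Matrix.det_fin_two]
  simp
  ring

theorem norm_im_mul_star (X Y : ℍ[ℝ]) : ‖(Y * star X).im‖ = ‖(star X * Y).im‖ := by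
  refine (mul_self_inj (norm_nonneg _) (norm_nonneg _)).1 ?_
  rw [← Quaternion.normSq_eq_norm_mul_self, ← Quaternion.normSq_eq_norm_mul_self]
  simp only [Quaternion.normSq_def']
  simp
  ring

theorem halfFrobSq_biquatMat_mul (X Y X' Y' : ℍ[ℝ]) :
    halfFrobSq (biquatMat (X, Y) * biquatMat (X', Y')) =
      (Quaternion.normSq X + Quaternion.normSq Y) * (Quaternion.normSq X' + Quaternion.normSq Y') +
        4 * inner ℝ (star X * Y).im (Y' * star X').im := by
  simp only [halfFrobSq, ← Complex.normSq_eq_norm_sq, Complex.normSq_apply, Quaternion.normSq_def',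
    biquatMat_apply, quatMat_apply, Quaternion.inner_def]
  simp [Matrix.mul_apply, Fin.sum_univ_two]
  ring

/-- Equality in Cauchy–Schwarz: the cross term of h(AB) is four times the inner product of these
vectors, and each gap is twice the length of one of them. -/
theorem norm_biquatMat_mul_eq_iff (X Y X' Y' : ℍ[ℝ]) :
    ‖biquatMat (X, Y) * biquatMat (X', Y')‖ = ‖biquatMat (X, Y)‖ * ‖biquatMat (X', Y')‖ ↔
      SameRay ℝ (star X * Y).im (Y' * star X').im := by
  rw [norm_mul_eq_iff, halfFrobSq_biquatMat_mul, halfFrobSq_biquatMat, halfFrobSq_biquatMat,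
    singularGap_biquatMat, singularGap_biquatMat, ← norm_im_mul_star X' Y', sameRay_iff_norm_smul_eq,
    eq_comm (a := ‖(star X * Y).im‖ • (Y' * star X').im), ← inner_eq_norm_mul_iff_real]
  constructor <;> intro h <;> linarith

theorem sameRay_smul_iff {t : ℝ} (ht : t ≠ 0) (u v : ℍ[ℝ]) :
    SameRay ℝ (t • u) (t • v) ↔ SameRay ℝ u v := by
  constructor
  · intro h
    simpa only [LinearMap.smul_apply, LinearMap.id_apply, smul_smul, inv_mul_cancel₀ ht,
      one_smul] using h.map (t⁻¹ • (LinearMap.id : ℍ[ℝ] →ₗ[ℝ] ℍ[ℝ]))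
  · intro h
    exact h.map (t • (LinearMap.id : ℍ[ℝ] →ₗ[ℝ] ℍ[ℝ]))

/-- The shear by sY contributes only a multiple of Y*Y, which is real. Hence X + iY ↦ X + μY
rescales both test vectors by Im μ, and a common nonzero factor, even a negative one, keeps the ray
relation. -/
theorem im_star_add_smul_mul_smul (X Y : ℍ[ℝ]) (s t : ℝ) :
    (star (X + s • Y) * (t • Y)).im = t • (star X * Y).im := by
  ext <;> simp [-mul_eq_mul_left_iff] <;> ring

theorem im_smul_mul_star_add_smul (X Y : ℍ[ℝ]) (s t : ℝ) :
    (t • Y * star (X + s • Y)).im = t • (Y * star X).im := by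
  ext <;> simp [-mul_eq_mul_left_iff] <;> ring

/-- The map `X + iY ↦ X + μY` preserves norm-multiplicative pairs in both directions. -/
theorem norm_quatMat_add_smul_mul_eq_iff {μ : ℂ} (hμ : μ.im ≠ 0) (X Y X' Y' : ℍ[ℝ]) :
    ‖(quatMat X + μ • quatMat Y) * (quatMat X' + μ • quatMat Y')‖ =
        ‖quatMat X + μ • quatMat Y‖ * ‖quatMat X' + μ • quatMat Y'‖ ↔
      SameRay ℝ (star X * Y).im (Y' * star X').im := by
  rw [quatMat_add_smul, quatMat_add_smul, norm_biquatMat_mul_eq_iff, im_star_add_smul_mul_smul,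
    im_smul_mul_star_add_smul, sameRay_smul_iff hμ]

theorem preserves_of_hasQuaternionForm {T : Mat2 ℂ → Mat2 ℂ} {U V : Mat2 ℂ}
    (hU : U ∈ Matrix.unitaryGroup (Fin 2) ℂ) (hV : V ∈ Matrix.unitaryGroup (Fin 2) ℂ) {γ μ : ℂ}
    (hγ : γ ≠ 0) (hμ : μ.im ≠ 0) (h : HasQuaternionForm T U V γ μ) :
    PreservesNormMulPairs T := by
  have hUU : U * Uᴴ = 1 := Matrix.mem_unitaryGroup_iff.1 hU
  have hrep : ∀ A : Mat2 ℂ, ∃ X Y, A = (1 : ℂ) • (U * biquatMat (X, Y) * Uᴴ) := by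
    intro A
    obtain ⟨⟨X, Y⟩, hXY⟩ := biquatMat.surjective (Uᴴ * A * U)
    refine ⟨X, Y, ?_⟩
    rw [hXY, one_smul]
    calc A = (U * Uᴴ) * A * (U * Uᴴ) := by rw [hUU]; simp
      _ = _ := by simp only [mul_assoc]
  have hform : ∀ X Y, γ • (V * T ((1 : ℂ) • (U * biquatMat (X, Y) * Uᴴ)) * Vᴴ) =
      quatMat X + μ • quatMat Y := by
    intro X Y
    rw [one_smul]
    exact h _ (mem_quaternionSpace_iff.2 ⟨X, rfl⟩) _ (mem_quaternionSpace_iff.2 ⟨Y, rfl⟩)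
  intro A B hAB
  obtain ⟨X, Y, rfl⟩ := hrep A
  obtain ⟨X', Y', rfl⟩ := hrep B
  rw [norm_mul_eq_iff_smul_conj hU one_ne_zero, norm_biquatMat_mul_eq_iff] at hAB
  rw [← norm_mul_eq_iff_smul_conj hV hγ, hform, hform, norm_quatMat_add_smul_mul_eq_iff hμ]
  exact hAB

theorem eq_I_of_complex_linear {T : Mat2 ℂ → Mat2 ℂ} {U V : Mat2 ℂ} {γ μ : ℂ}
    (hT : ∀ (z : ℂ) (A : Mat2 ℂ), T (z • A) = z • T A) (h : HasQuaternionForm T U V γ μ) :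
    μ = Complex.I := by
  have h1 : (1 : Mat2 ℂ) ∈ quaternionSpace := mem_quaternionSpace_iff.2 ⟨1, quatMat_one⟩
  have e1 := h 1 h1 0 (zero_mem _)
  have e2 := h 0 (zero_mem _) 1 h1
  simp only [smul_zero, add_zero, zero_add, Matrix.mul_smul, Matrix.smul_mul, hT] at e1 e2
  rw [smul_comm, e1] at e2
  simpa using (congrFun (congrFun e2 0) 0).symm

theorem exists_eq_smul_of_im_eq_zero {X Y : ℍ[ℝ]} (hX : X ≠ 0) (h : (star X * Y).im = 0) :
    ∃ r : ℝ, Y = r • X := by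
  refine ⟨(Quaternion.normSq X)⁻¹ * (star X * Y).re, ?_⟩
  have h1 : star X * Y = (star X * Y).re • (1 : ℍ[ℝ]) := by
    conv_lhs => rw [← Quaternion.re_add_im (star X * Y), h, add_zero]
    ext <;> simp
  have h2 : (Quaternion.normSq X) • Y = (star X * Y).re • X := by
    have : X * (star X * Y) = (Quaternion.normSq X) • Y := by
      rw [← mul_assoc, Quaternion.self_mul_star, Quaternion.coe_mul_eq_smul]
    rw [← this]
    conv_lhs => rw [h1]
    rw [mul_smul_comm, mul_one]
  rw [mul_smul, ← h2, smul_smul, inv_mul_cancel₀ (Quaternion.normSq_ne_zero.2 hX), one_smul]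

theorem im_star_mul_comm (X Y : ℍ[ℝ]) : (star Y * X).im = -(star X * Y).im := by
  ext <;> simp <;> ring

/-- Multiples of unitary matrices are sent to multiples of unitary matrices. -/
theorem PreservesNormMulPairs.im_eq_zero {T : Mat2 ℂ → Mat2 ℂ} (hT : Function.Surjective T)
    (h : PreservesNormMulPairs T) {X Y X' Y' : ℍ[ℝ]}
    (hXY : T (biquatMat (X, Y)) = biquatMat (X', Y')) (h0 : (star X * Y).im = 0) :
    (star X' * Y').im = 0 := by
  -- The image must pair with every matrix, in particular with one whose test vector is the negative
  -- of its own.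
  obtain ⟨B, hB⟩ := hT (biquatMat (1, -(star X' * Y').im))
  obtain ⟨⟨Z, W⟩, rfl⟩ := biquatMat.surjective B
  have := h _ _ ((norm_biquatMat_mul_eq_iff X Y Z W).2 (by rw [h0]; exact SameRay.zero_left _))
  rw [hXY, hB, norm_biquatMat_mul_eq_iff, star_one, mul_one, Quaternion.im_neg,
    Quaternion.im_idem] at this
  exact eq_zero_of_sameRay_self_neg this

/-- Every vector is an eigenvector of G ∘ φ⁻¹, so this map is a scalar. -/
theorem LinearMap.exists_eq_smul_of_forall {φ G : ℍ[ℝ] →ₗ[ℝ] ℍ[ℝ]} (hφ : Function.Bijective φ)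
    (h : ∀ x, ∃ r : ℝ, G x = r • φ x) : ∃ r : ℝ, ∀ x, G x = r • φ x := by
  let e := LinearEquiv.ofBijective φ hφ
  obtain ⟨r, hr⟩ := (G ∘ₗ e.symm.toLinearMap).exists_eq_smul_id_of_forall_notLinearIndependent
    (fun v => by
      obtain ⟨r, hr⟩ := h (e.symm v)
      have hv : φ (e.symm v) = v := e.apply_symm_apply v
      rw [hv] at hr
      intro hli
      rw [LinearIndependent.pair_iff] at hli
      have := hli r (-1) (by simp [hr])
      simp at this)
  refine ⟨r, fun x => ?_⟩
  have := congrArg (fun L => L (φ x)) hr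
  have hx : e.symm (φ x) = x := e.symm_apply_apply x
  simpa [hx] using this

/-- A real-linear injection of the quaternions into the multiples of unitary matrices that sends
`1` to a quaternion has only quaternion values. -/
theorem snd_eq_zero_of_im_eq_zero {f g : ℍ[ℝ] →ₗ[ℝ] ℍ[ℝ]}
    (hinj : ∀ x, f x = 0 → g x = 0 → x = 0) (h : ∀ x, (star (f x) * g x).im = 0)
    (hg : g 1 = 0) (x₀ : ℍ[ℝ]) : g x₀ = 0 := by
  by_contra hx₀
  have hP : f 1 ≠ 0 := fun h0 => one_ne_zero (hinj 1 h0 hg)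
  have hgP : ∀ x, ∃ r : ℝ, g x = r • f 1 := by
    intro x
    apply exists_eq_smul_of_im_eq_zero hP
    have := h (x + 1)
    rw [map_add, map_add, hg, add_zero, star_add, add_mul, Quaternion.im_add, h, zero_add] at this
    exact this
  have hfP' : ∀ x, g x ≠ 0 → ∃ r : ℝ, f x = r • f 1 := by
    intro x hx
    obtain ⟨r, hr⟩ := exists_eq_smul_of_im_eq_zero (X := g x) (Y := f x) hx
      (by rw [im_star_mul_comm, h, neg_zero])
    obtain ⟨s, hs⟩ := hgP x
    exact ⟨r * s, by rw [hr, hs, smul_smul]⟩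
  have hfP : ∀ x, ∃ r : ℝ, f x = r • f 1 := by
    intro x
    by_cases hx : g x = 0
    · obtain ⟨r, hr⟩ := hfP' (x + x₀) (by rw [map_add, hx, zero_add]; exact hx₀)
      obtain ⟨s, hs⟩ := hfP' x₀ hx₀
      exact ⟨r - s, by rw [sub_smul, ← hr, ← hs, map_add, add_sub_cancel_right]⟩
    · exact hfP' x hx
  -- Both f and g now take values in the line ℝ·f(1), so (f, g) would embed a four-dimensional space
  -- in a plane.
  let L : ℍ[ℝ] →ₗ[ℝ] ℝ × ℝ :=
    ((innerₛₗ ℝ (f 1)) ∘ₗ f).prod ((innerₛₗ ℝ (f 1)) ∘ₗ g)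
  have hPP : inner ℝ (f 1) (f 1) ≠ 0 := inner_self_ne_zero.2 hP
  have hL : Function.Injective L := by
    rw [injective_iff_map_eq_zero]
    intro x hx
    obtain ⟨r, hr⟩ := hfP x
    obtain ⟨s, hs⟩ := hgP x
    have e1 : inner ℝ (f 1) (f x) = 0 := congrArg Prod.fst hx
    have e2 : inner ℝ (f 1) (g x) = 0 := congrArg Prod.snd hx
    rw [hr, inner_smul_right] at e1
    rw [hs, inner_smul_right] at e2
    apply hinj
    · rw [hr, (mul_eq_zero.1 e1).resolve_right hPP, zero_smul]
    · rw [hs, (mul_eq_zero.1 e2).resolve_right hPP, zero_smul]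
  have := LinearMap.finrank_le_finrank_of_injective hL
  rw [Quaternion.finrank_eq_four, Module.finrank_prod, Module.finrank_self] at this
  norm_num at this

theorem exists_eq_smul_quatMat {X Y : ℍ[ℝ]} (h : (star X * Y).im = 0) :
    ∃ z : ℂ, z ≠ 0 ∧ ∃ P, biquatMat (X, Y) = z • quatMat P := by
  rcases eq_or_ne X 0 with rfl | hX
  · exact ⟨Complex.I, Complex.I_ne_zero, Y, by simp [biquatMat_apply]⟩
  · obtain ⟨r, rfl⟩ := exists_eq_smul_of_im_eq_zero hX h
    refine ⟨1 + r * Complex.I, ?_, X, ?_⟩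
    · intro h0
      simpa using congrArg Complex.re h0
    · rw [biquatMat_apply, map_smul, add_smul, one_smul, mul_smul, Complex.coe_smul, smul_comm]

/-- A preserver is, up to a complex factor, of the form `X + iY ↦ φ(X) + μ φ(Y)`. -/
theorem PreservesNormMulPairs.exists_tensor_form {T : Mat2 ℂ →ₗ[ℝ] Mat2 ℂ}
    (hT : Function.Bijective T) (h : PreservesNormMulPairs T) :
    ∃ z : ℂ, z ≠ 0 ∧ ∃ μ : ℂ, μ.im ≠ 0 ∧ ∃ φ : ℍ[ℝ] →ₗ[ℝ] ℍ[ℝ], Function.Bijective φ ∧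
      ∀ X Y, T (biquatMat (X, Y)) = z • (quatMat (φ X) + μ • quatMat (φ Y)) := by
  -- The image of the identity is a complex multiple of a quaternion; dividing by that factor makes
  -- the hypothesis g 1 = 0 of `snd_eq_zero_of_im_eq_zero` available.
  obtain ⟨z, hz, P, hP⟩ : ∃ z : ℂ, z ≠ 0 ∧ ∃ P, T (biquatMat (1, 0)) = z • quatMat P := by
    obtain ⟨⟨X, Y⟩, hXY⟩ := biquatMat.surjective (T (biquatMat (1, 0)))
    rw [← hXY]
    exact exists_eq_smul_quatMat (h.im_eq_zero hT.2 hXY.symm (by simp))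
  let S : Mat2 ℂ →ₗ[ℝ] Mat2 ℂ := z⁻¹ • T
  have hTS : ∀ A, T A = z • S A := fun A => by
    simp [S, smul_smul, hz]
  have hS : Function.Bijective S := by
    constructor
    · intro A B hAB
      apply hT.1
      rw [hTS, hTS, hAB]
    · intro B
      obtain ⟨A, hA⟩ := hT.2 (z • B)
      refine ⟨A, ?_⟩
      rw [hTS] at hA
      exact smul_right_injective _ hz hA
  have hSP : PreservesNormMulPairs S := by
    intro A B hAB
    have := h A B hAB
    rw [hTS, hTS] at this
    have h1 := norm_mul_eq_iff_smul_conj (one_mem (Matrix.unitaryGroup (Fin 2) ℂ)) hz (S A) (S B)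
    simp only [one_mul, Matrix.conjTranspose_one, mul_one] at h1
    exact h1.1 this
  let R : ℍ[ℝ] × ℍ[ℝ] →ₗ[ℝ] ℍ[ℝ] × ℍ[ℝ] :=
    biquatMat.symm.toLinearMap ∘ₗ S ∘ₗ biquatMat.toLinearMap
  have hSR : ∀ p, S (biquatMat p) = biquatMat (R p) := fun p => by simp [R]
  have hR : Function.Injective R := by
    intro p q hpq
    apply biquatMat.injective
    apply hS.1
    rw [hSR, hSR, hpq]
  have hconf : ∀ p : ℍ[ℝ] × ℍ[ℝ], (star p.1 * p.2).im = 0 →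
      (star (R p).1 * (R p).2).im = 0 :=
    fun p hp => hSP.im_eq_zero hS.2 (hSR p) hp
  let φ : ℍ[ℝ] →ₗ[ℝ] ℍ[ℝ] := LinearMap.fst ℝ _ _ ∘ₗ R ∘ₗ LinearMap.inl ℝ _ _
  let g : ℍ[ℝ] →ₗ[ℝ] ℍ[ℝ] := LinearMap.snd ℝ _ _ ∘ₗ R ∘ₗ LinearMap.inl ℝ _ _
  let F : ℍ[ℝ] →ₗ[ℝ] ℍ[ℝ] := LinearMap.fst ℝ _ _ ∘ₗ R ∘ₗ LinearMap.inr ℝ _ _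
  let G : ℍ[ℝ] →ₗ[ℝ] ℍ[ℝ] := LinearMap.snd ℝ _ _ ∘ₗ R ∘ₗ LinearMap.inr ℝ _ _
  have hR1 : ∀ X, R (X, 0) = (φ X, g X) := fun X => rfl
  have hR2 : ∀ Y, R (0, Y) = (F Y, G Y) := fun Y => rfl
  have hg1 : g 1 = 0 := by
    have : R (1, 0) = (P, 0) := by
      apply biquatMat.injective
      rw [← hSR, biquatMat_zero_right P]
      apply smul_right_injective _ hz
      simp only
      rw [← hTS, hP]
    rw [hR1] at this
    exact congrArg Prod.snd this
  have hg : ∀ X, g X = 0 := by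
    apply snd_eq_zero_of_im_eq_zero (f := φ) _ _ hg1
    · intro X h1 h2
      have : R (X, 0) = 0 := by rw [hR1, h1, h2]; rfl
      exact congrArg Prod.fst (hR (this.trans (map_zero R).symm))
    · intro X
      exact hconf (X, 0) (by simp)
  have hφi : Function.Injective φ := by
    intro X Y hXY
    have : R (X, 0) = R (Y, 0) := by rw [hR1, hR1, hXY, hg, hg]
    exact congrArg Prod.fst (hR this)
  have hφ : Function.Bijective φ := ⟨hφi, LinearMap.injective_iff_surjective.1 hφi⟩
  have hG0 : ∀ Y, G Y = 0 → Y = 0 := by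
    intro Y hY
    obtain ⟨X, hX⟩ := hφ.2 (F Y)
    have : R (X, 0) = R (0, Y) := by rw [hR1, hR2, hg, hY, hX]
    exact (congrArg Prod.snd (hR this)).symm
  have hFG : ∀ Y, (star (F Y) * G Y).im = 0 := fun Y => hconf (0, Y) (by simp)
  have hφG : ∀ Y, (star (φ Y) * G Y).im = 0 := by
    intro Y
    -- (1 + i)Y is again a multiple of a unitary; subtracting the condition at iY leaves G(Y)
    -- parallel to φ(Y).
    have h1 := hconf (Y, Y) (by simp [Quaternion.star_mul_self])
    have h2 : R (Y, Y) = (φ Y + F Y, G Y) := by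
      have : ((Y, Y) : ℍ[ℝ] × ℍ[ℝ]) = (Y, 0) + (0, Y) := by simp
      rw [this, map_add, hR1, hR2, hg]; simp
    rw [h2] at h1
    simp only [star_add, add_mul, Quaternion.im_add, hFG, add_zero] at h1
    exact h1
  have hGr : ∀ Y, ∃ r : ℝ, G Y = r • φ Y := by
    intro Y
    rcases eq_or_ne Y 0 with rfl | hY
    · exact ⟨0, by simp⟩
    · exact exists_eq_smul_of_im_eq_zero ((map_ne_zero_iff φ hφi).2 hY) (hφG Y)
  obtain ⟨t, ht⟩ := LinearMap.exists_eq_smul_of_forall hφ hGr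
  have ht0 : t ≠ 0 := by
    intro h0
    exact one_ne_zero (hG0 1 (by rw [ht, h0, zero_smul]))
  have hFr : ∀ Y, ∃ r : ℝ, F Y = r • φ Y := by
    intro Y
    rcases eq_or_ne Y 0 with rfl | hY
    · exact ⟨0, by simp⟩
    · obtain ⟨r, hr⟩ := exists_eq_smul_of_im_eq_zero (X := G Y) (Y := F Y)
        (fun h0 => hY (hG0 Y h0)) (by rw [im_star_mul_comm, hFG, neg_zero])
      exact ⟨r * t, by rw [hr, ht, smul_smul]⟩
  obtain ⟨s, hs⟩ := LinearMap.exists_eq_smul_of_forall hφ hFr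
  refine ⟨z, hz, ⟨s, t⟩, ht0, φ, hφ, fun X Y => ?_⟩
  have hXY : ((X, Y) : ℍ[ℝ] × ℍ[ℝ]) = (X, 0) + (0, Y) := by simp
  rw [hTS, hSR, quatMat_add_smul, hXY, map_add, hR1, hR2, hg, hs, ht]
  simp

/-- The complex case of the classification. -/
theorem preservesNormMulPairs_complex_iff (T : Mat2 ℂ →ₗ[ℝ] Mat2 ℂ) (hT : Function.Bijective T) :
    PreservesNormMulPairs T ↔
      ∃ U ∈ Matrix.unitaryGroup (Fin 2) ℂ, ∃ V ∈ Matrix.unitaryGroup (Fin 2) ℂ,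
        ∃ γ : ℂ, γ ≠ 0 ∧ ∃ μ : ℂ, μ.im ≠ 0 ∧ HasQuaternionForm T U V γ μ := by
  constructor
  · intro h
    obtain ⟨z, hz, μ, hμ, φ, hφ, hform⟩ := h.exists_tensor_form hT
    have hφP : PreservesPlanePairs φ := by
      intro X Y X' Y' hr
      have := h _ _ ((norm_biquatMat_mul_eq_iff X Y X' Y').2 hr)
      rw [hform, hform] at this
      have h1 := norm_mul_eq_iff_smul_conj (one_mem (Matrix.unitaryGroup (Fin 2) ℂ)) hz
        (quatMat (φ X) + μ • quatMat (φ Y)) (quatMat (φ X') + μ • quatMat (φ Y'))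
      simp only [one_mul, Matrix.conjTranspose_one, mul_one] at h1
      exact (norm_quatMat_add_smul_mul_eq_iff hμ _ _ _ _).1 (h1.1 this)
    obtain ⟨c, hc, v, hv1, hv2, hv⟩ := hφP.exists_conj hφ
    have hcC : (c : ℂ) ≠ 0 := by exact_mod_cast hc
    have hVH : (quatMat (star v))ᴴ = quatMat v := by rw [← quatMat_star, star_star]
    refine ⟨1, one_mem _, quatMat (star v), ?_, (c * z)⁻¹, inv_ne_zero (mul_ne_zero hcC hz), μ, hμ,
      ?_⟩
    · rw [Matrix.mem_unitaryGroup_iff, Matrix.star_eq_conjTranspose, hVH, ← quatMat_mul, hv2,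
        quatMat_one]
    · intro A hA B hB
      obtain ⟨X, rfl⟩ := mem_quaternionSpace_iff.1 hA
      obtain ⟨Y, rfl⟩ := mem_quaternionSpace_iff.1 hB
      have hconj : ∀ x, quatMat (star v) * quatMat (φ x) * quatMat v = (c : ℂ) • quatMat x := by
        intro x
        rw [← quatMat_mul, ← quatMat_mul, hv, mul_smul_comm, smul_mul_assoc, map_smul,
          Complex.coe_smul]
        congr 2
        calc star v * (v * x * star v) * v = (star v * v) * x * (star v * v) := by
              simp only [mul_assoc]
          _ = x := by rw [hv2, one_mul, mul_one]
      have := hform X Y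
      rw [biquatMat_apply] at this
      rw [Matrix.conjTranspose_one, one_mul, mul_one, this, hVH]
      simp only [Matrix.mul_smul, Matrix.smul_mul, mul_add, add_mul, hconj]
      rw [smul_smul, mul_inv, smul_comm μ, ← smul_add, smul_smul]
      have hone : (c : ℂ)⁻¹ * z⁻¹ * z * c = 1 := by field_simp
      rw [hone, one_smul]
  · rintro ⟨U, hU, V, hV, γ, hγ, μ, hμ, h⟩
    exact preserves_of_hasQuaternionForm hU hV hγ hμ h

end ComplexCase

theorem mainTheorem5 :
    (∀ T : Mat2 ℝ →ₗ[ℝ] Mat2 ℝ, Function.Bijective T →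
      (PreservesNormMulPairs T ↔
        ∃ γ : ℝ, γ ≠ 0 ∧ ∃ c : ℝ, 0 < c ∧ ∃ U ∈ Matrix.unitaryGroup (Fin 2) ℝ,
          ∀ A : Mat2 ℝ, T A = γ • (U * rotReflScale c A * Uᴴ))) ∧
    (∀ T : Mat2 ℂ →ₗ[ℝ] Mat2 ℂ, Function.Bijective T →
      (PreservesNormMulPairs T ↔
        ∃ U ∈ Matrix.unitaryGroup (Fin 2) ℂ, ∃ V ∈ Matrix.unitaryGroup (Fin 2) ℂ,
          ∃ γ : ℂ, γ ≠ 0 ∧ ∃ μ : ℂ, μ.im ≠ 0 ∧ HasQuaternionForm T U V γ μ) ∧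
      ((∀ (z : ℂ) (A : Mat2 ℂ), T (z • A) = z • T A) →
        ∀ U ∈ Matrix.unitaryGroup (Fin 2) ℂ, ∀ V ∈ Matrix.unitaryGroup (Fin 2) ℂ,
          ∀ γ : ℂ, γ ≠ 0 → ∀ μ : ℂ, μ.im ≠ 0 → HasQuaternionForm T U V γ μ →
            μ = Complex.I)) := by
  exact ⟨preservesNormMulPairs_real_iff, fun T hT =>
    ⟨preservesNormMulPairs_complex_iff T hT, fun hlin U _ V _ γ _ μ _ h =>
      eq_I_of_complex_linear hlin h⟩⟩
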